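/- Let $d\in\mathbb N$, let $\mathcal H,\mathcal J$ be complex Hilbert spaces, and let $F^2_d$ be the full Fock space with orthonormal basis $(e_\alpha)$ indexed by the words $\alpha$ in $d$ letters, with left creation operators $L_k e_\alpha=e_{k\alpha}$. An element $f=\sum_\alpha e_\alpha\otimes f_\alpha$ of $F^2_d\otimes\mathcal H$ is identified with the function $f(Z)=\sum_\alpha Z^\alpha\otimes f_\alpha$ on the non-commutative unit ball (all $d$-tuples $Z=(Z_1,\dots,Z_d)$ of complex $n\times n$ matrices, $n\ge 1$, with $\sum_k Z_kZ_k^*<I_n$). Let $A\in\mathscr R_d(\mathcal H,\mathcal J)$ (the right free Schur class), i.e. $A=M^R_{A^\dagger(Z)}:F^2_d\otimes\mathcal H\to F^2_d\otimes\mathcal J$ is a contraction acting as right multiplication $f(Z)\mapsto f(Z)\bullet_R A^\dagger(Z)$ by a free function $A^\dagger(Z)\in\mathbb C^{n\times n}\otimes\mathcal L(\mathcal H,\mathcal J)$, where $\bullet_R$ multiplies the matrices in the order written and applies the operator entries of $A^\dagger(Z)$ to the vector entries of $f(Z)$. Let $A(0)=A^\dagger(0)\in\mathcal L(\mathcal H,\mathcal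 J)$. Let $\mathscr H^R(A)$ be the reproducing kernel Hilbert space of $\mathcal J$-valued free functions on the non-commutative ball with kernel $$K^A(Z,W)[P]=K(Z,W)[P]\otimes I_{\mathcal J}-(K(Z,W)\otimes I_{\mathcal J})\big[A^\dagger(Z)(P\otimes I_{\mathcal H})A^\dagger(W)^*\big],\qquad K(Z,W)[P]=\sum_\alpha Z^\alpha P (W^{\alpha})^*,$$ and let $K^A_0:\mathcal J\to\mathscr H^R(A)$ be the adjoint of $F\mapsto F(0)$. For $h\in\mathcal H$ write $Ah$ for the function $(Ah)(Z)=A^\dagger(Z)(I_n\otimes h)$, put $\mathcal D_A=\{h\in\mathcal H: Ah\in\mathscr H^R(A)\}$, and let $\hat A:\mathcal D_A\to\mathscr H^R(A)$, $\hat Ah=Ah$. Then $X=(L^*\otimes I_{\mathcal J})|_{\mathscr H^R(A)}:\mathscr H^R(A)\to\mathscr H^R(A)\otimes\mathbb C^d$ and $\mathbf A=(L^*\otimes I_{\mathcal J})A:\mathcal H\to\mathscr H^R(A)\otimes\mathbb C^d$, $\mathbf A_kh=(L_k^*\otimes I_{\mathcal J})A(1\otimes h)$, where $1=e_\emptyset$,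 are well-defined bounded operators, $I-A(0)^*A(0)-\mathbf A^*\mathbf A\ge 0$, and with $a_\emptyset\ge 0$ defined by $$a_\emptyset^2=I-A(0)^*A(0)-\mathbf A^*\mathbf A$$ the following hold. 1. $\hat A$ is closed, and $\operatorname{Dom}(\hat A)=\mathcal D_A=\operatorname{ran}(a_\emptyset)$. 2. View $\hat A$ as a closed, densely defined operator from $\mathcal D_A\subseteq\overline{\mathcal D_A}$ to $\mathscr H^R(A)$. For all $h\in\operatorname{Dom}(\hat A^*\hat A)$, $a_\emptyset^2(I+\hat A^*\hat A)h=h$. 3. $a_\emptyset^2$ maps $\overline{\mathcal D_A}$ into itself, $I+\hat A^*\hat A$ is injective, and $a_\emptyset^2|_{\overline{\mathcal D_A}}=(I_{\overline{\mathcal D_A}}+\hat A^*\hat A)^{-1}$ (as operators with domain $\overline{\mathcal D_A}$). 4. $\hat Aa_\emptyset:\mathcal H\to\mathscr H^R(A)$ is bounded, and $I-X^*X=K^A_0(K^A_0)^*+(\hat Aa_\emptyset)(\hat Aa_\emptyset)^*$. -/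

import Mathlib

open scoped InnerProductSpace ComplexOrder

noncomputable section

namespace FreeDBR

/-! ### Non-commutative unit ball and the full Fock space -/

/-- Level `n` of the non-commutative unit ball: `d`-tuples of complex `n × n` matrices which form
a strict row contraction, `∑ Z_k Z_k^* < I`. -/
def NCBall (d n : ℕ) : Type :=
  {Z : Fin d → Matrix (Fin n) (Fin n) ℂ // (1 - ∑ k, Z k * (Z k).conjTranspose).PosDef}

/-- The origin of level `n`. -/
def NCBall.zero (d n : ℕ) : NCBall d n :=
  ⟨fun _ => 0, by simpa using Matrix.PosDef.one⟩

/-- The monomial `Z^α = Z_{i₁} ⋯ Z_{iₘ}` of a word `α = i₁ ⋯ iₘ`. -/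
def NCBall.word {d n : ℕ} (Z : NCBall d n) (α : List (Fin d)) : Matrix (Fin n) (Fin n) ℂ :=
  (α.map Z.1).prod

/-- The index of a matrix entry of a function on the NC ball: a level `n`, a point `Z` of level `n`
and the position `(i, j)` of an entry of an `n × n` matrix. A function `f` on the NC ball with
`f(Z) ∈ ℂ^{n×n} ⊗ V` is the same as the function `(n, Z, i, j) ↦ f(Z)_{ij} ∈ V`. -/
structure NCPoint (d : ℕ) where
  n : ℕ
  Z : NCBall d n
  i : Fin n
  j : Fin n

/-- The vector-valued full Fock space `F²_d ⊗ V`, with orthonormal basis `e_α` of `F²_d` indexed by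
words: `f = ∑_α e_α ⊗ f_α` with `∑ ‖f_α‖² < ∞`. -/
abbrev Fock (d : ℕ) (V : Type*) [NormedAddCommGroup V] [InnerProductSpace ℂ V] :=
  lp (fun _ : List (Fin d) => V) 2

/-! ### Square summability of the entries of monomials -/

section Words

variable {d n : ℕ}

theorem sq_vecMul_add (Z : NCBall d n) (w : Fin n → ℂ) :
    (star (star w) ⬝ᵥ ((1 - ∑ k, Z.1 k * (Z.1 k).conjTranspose).mulVec (star w)) : ℂ) =
      ((∑ j, ‖w j‖ ^ 2 - ∑ k, ∑ j, ‖(Matrix.vecMul w (Z.1 k)) j‖ ^ 2 : ℝ) : ℂ) := by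
  have h : ∀ v : Fin n → ℂ, v ⬝ᵥ star v = ((∑ j, ‖v j‖ ^ 2 : ℝ) : ℂ) := by
    intro v
    simp [dotProduct, Complex.mul_conj, Complex.normSq_eq_norm_sq]
  have h2 : ∀ k, w ⬝ᵥ ((Z.1 k * (Z.1 k).conjTranspose).mulVec (star w)) =
      ((∑ j, ‖(Matrix.vecMul w (Z.1 k)) j‖ ^ 2 : ℝ) : ℂ) := by
    intro k
    rw [← h, ← Matrix.mulVec_mulVec, Matrix.dotProduct_mulVec, Matrix.star_vecMul]
  rw [star_star, Matrix.sub_mulVec, dotProduct_sub, Matrix.one_mulVec, h, Matrix.sum_mulVec,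
    dotProduct_sum]
  simp only [h2]
  push_cast
  rfl

/-- All words of length at most `N`. -/
def wordsUpTo (d : ℕ) : ℕ → Finset (List (Fin d))
  | 0 => {[]}
  | N + 1 => insert [] ((Finset.univ ×ˢ wordsUpTo d N).image fun p => p.1 :: p.2)

theorem mem_wordsUpTo (α : List (Fin d)) : ∀ N, α.length ≤ N → α ∈ wordsUpTo d N := by
  induction α with
  | nil => intro N _; cases N <;> simp [wordsUpTo]
  | cons k α ih =>
    intro N hN
    cases N with
    | zero => simp at hN
    | succ N =>
      simp only [wordsUpTo, Finset.mem_insert, Finset.mem_image, Finset.mem_product]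
      exact Or.inr ⟨(k, α), ⟨Finset.mem_univ _, ih N (by simpa using hN)⟩, rfl⟩

theorem exists_sq_bound (Z : NCBall d n) : ∃ δ : ℝ, 0 < δ ∧ ∀ w : Fin n → ℂ,
    δ * ∑ j, ‖w j‖ ^ 2 ≤ ∑ j, ‖w j‖ ^ 2 - ∑ k, ∑ j, ‖(Matrix.vecMul w (Z.1 k)) j‖ ^ 2 := by
  set p : EuclideanSpace ℂ (Fin n) → ℝ := fun w =>
    ∑ j, ‖w j‖ ^ 2 - ∑ k, ∑ j, ‖(Matrix.vecMul w (Z.1 k)) j‖ ^ 2 with hp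
  have hpos : ∀ w : EuclideanSpace ℂ (Fin n), w ≠ 0 → 0 < p w := by
    intro w hw
    have := Z.2.dotProduct_mulVec_pos (x := star (w : Fin n → ℂ)) (by
      intro h
      apply hw
      ext i
      have := congrFun h i
      simpa using this)
    rw [sq_vecMul_add] at this
    exact_mod_cast this
  have hcont : Continuous p := by
    have : ∀ k j, Continuous fun w : EuclideanSpace ℂ (Fin n) =>
        (Matrix.vecMul w (Z.1 k)) j := by
      intro k j
      simp only [Matrix.vecMul, dotProduct]
      fun_prop
    simp only [hp]
    fun_prop
  have hq : ∀ w : EuclideanSpace ℂ (Fin n), ∑ j, ‖w j‖ ^ 2 = ‖w‖ ^ 2 := fun w =>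
    (EuclideanSpace.norm_sq_eq w).symm
  have hhom : ∀ (c : ℝ) (w : EuclideanSpace ℂ (Fin n)), p ((c : ℂ) • w) = c ^ 2 * p w := by
    intro c w
    simp only [hp, WithLp.ofLp_smul, Matrix.smul_vecMul, Pi.smul_apply, norm_smul, mul_pow,
      Complex.norm_real, Real.norm_eq_abs, sq_abs, ← Finset.mul_sum]
    ring
  rcases isEmpty_or_nonempty (Fin n) with he | he
  · exact ⟨1, one_pos, fun w => by simp⟩
  · obtain ⟨w₀, hw₀, hmin⟩ := (isCompact_sphere (0 : EuclideanSpace ℂ (Fin n)) 1).exists_isMinOn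
      (NormedSpace.sphere_nonempty.2 zero_le_one) hcont.continuousOn
    refine ⟨p w₀, hpos w₀ (by rintro rfl; simp at hw₀), fun w => ?_⟩
    by_cases hw : w = 0
    · simp [hw]
    · set v : EuclideanSpace ℂ (Fin n) := WithLp.toLp 2 w with hv
      have hvne : v ≠ 0 := by
        intro h
        exact hw (by simpa [hv] using h)
      have hn : (0 : ℝ) < ‖v‖ := norm_pos_iff.2 hvne
      have h1 : p w₀ ≤ p (((‖v‖⁻¹ : ℝ) : ℂ) • v) := hmin (by
        simp only [mem_sphere_zero_iff_norm, norm_smul, Complex.norm_real, norm_inv, norm_norm]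
        field_simp)
      rw [hhom] at h1
      have h2 := hq v
      change p w₀ * ∑ j, ‖v j‖ ^ 2 ≤ p v
      rw [h2]
      have : (‖v‖⁻¹ ^ 2 * p v) * ‖v‖ ^ 2 = p v := by field_simp
      nlinarith [mul_le_mul_of_nonneg_right h1 (sq_nonneg ‖v‖)]

theorem sum_words_le (Z : NCBall d n) {δ : ℝ}
    (hδ : ∀ w : Fin n → ℂ,
      δ * ∑ j, ‖w j‖ ^ 2 ≤ ∑ j, ‖w j‖ ^ 2 - ∑ k, ∑ j, ‖(Matrix.vecMul w (Z.1 k)) j‖ ^ 2) (N : ℕ) :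
    ∀ w : Fin n → ℂ, δ * ∑ α ∈ wordsUpTo d N, ∑ j, ‖(Matrix.vecMul w (Z.word α)) j‖ ^ 2 ≤
      ∑ j, ‖w j‖ ^ 2 := by
  induction N with
  | zero =>
    intro w
    have h0 : (0 : ℝ) ≤ ∑ k, ∑ j, ‖(Matrix.vecMul w (Z.1 k)) j‖ ^ 2 := by positivity
    simpa [wordsUpTo, NCBall.word] using (hδ w).trans (by linarith)
  | succ N ih =>
    intro w
    rw [wordsUpTo, Finset.sum_insert (by simp), Finset.sum_image (by
      rintro ⟨a, b⟩ _ ⟨a', b'⟩ _ h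
      simpa using h), Finset.sum_product]
    have h1 : ∀ (k : Fin d) (α : List (Fin d)), Matrix.vecMul w (Z.word (k :: α)) =
        Matrix.vecMul (Matrix.vecMul w (Z.1 k)) (Z.word α) := by
      intro k α
      simp [NCBall.word, Matrix.vecMul_vecMul]
    simp only [h1, mul_add, Finset.mul_sum]
    have h2 : ∑ k, (δ * ∑ α ∈ wordsUpTo d N,
        ∑ j, ‖(Matrix.vecMul (Matrix.vecMul w (Z.1 k)) (Z.word α)) j‖ ^ 2) ≤
        ∑ k, ∑ j, ‖(Matrix.vecMul w (Z.1 k)) j‖ ^ 2 :=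
      Finset.sum_le_sum fun k _ => ih _
    have h3 := hδ w
    simp only [Finset.mul_sum] at h2 h3
    have h4 : Matrix.vecMul w (Z.word []) = w := by simp [NCBall.word]
    rw [h4]
    linarith

theorem summable_word_sq (Z : NCBall d n) (i j : Fin n) :
    Summable fun α => ‖Z.word α i j‖ ^ 2 := by
  obtain ⟨δ, hpos, hδ⟩ := exists_sq_bound Z
  refine summable_of_sum_le (c := δ⁻¹) (fun _ => by positivity) fun s => ?_
  have hsub : s ⊆ wordsUpTo d (s.sup List.length) := fun α hα =>
    mem_wordsUpTo α _ (Finset.le_sup (f := List.length) hα)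
  have h1 : ∀ α, ‖Z.word α i j‖ ^ 2 ≤
      ∑ j, ‖(Matrix.vecMul (Pi.single i 1) (Z.word α)) j‖ ^ 2 := by
    intro α
    rw [Matrix.single_one_vecMul]
    exact Finset.single_le_sum (f := fun j => ‖(Z.word α).row i j‖ ^ 2)
      (fun _ _ => by positivity) (Finset.mem_univ j)
  have h2 := sum_words_le Z hδ (s.sup List.length) (Pi.single i 1)
  have h3 : ∑ x, ‖(Pi.single i 1 : Fin n → ℂ) x‖ ^ 2 = (1 : ℝ) := by
    rw [Finset.sum_eq_single i] <;> simp +contextual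
  rw [h3] at h2
  calc ∑ α ∈ s, ‖Z.word α i j‖ ^ 2
      ≤ ∑ α ∈ wordsUpTo d (s.sup List.length), ‖Z.word α i j‖ ^ 2 :=
        Finset.sum_le_sum_of_subset_of_nonneg hsub fun _ _ _ => by positivity
    _ ≤ ∑ α ∈ wordsUpTo d (s.sup List.length),
          ∑ j, ‖(Matrix.vecMul (Pi.single i 1) (Z.word α)) j‖ ^ 2 :=
        Finset.sum_le_sum fun α _ => h1 α
    _ ≤ δ⁻¹ := by
        rw [← one_div, le_div_iff₀ hpos, mul_comm]
        exact h2

end Words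

/-! ### Fock space -/

section Fock

variable {d : ℕ} {V : Type*} [NormedAddCommGroup V] [InnerProductSpace ℂ V]

/-- `1 ⊗ h`, where `1 = e_∅` is the vacuum vector. -/
def vac (h : V) : Fock d V := lp.single 2 [] h

/-- The value `f(Z) = ∑_α Z^α ⊗ f_α ∈ ℂ^{n×n} ⊗ V` of an element of the free Hardy space
`H²(𝔹^d_ℕ) ⊗ V`, which is identified with `F²_d ⊗ V`. -/
def eval (f : Fock d V) {n : ℕ} (Z : NCBall d n) : Matrix (Fin n) (Fin n) V :=
  Matrix.of fun i j => ∑' α : List (Fin d), Z.word α i j • f α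

/-- The left creation operator `L_k ⊗ I_V`, `e_α ⊗ h ↦ e_{kα} ⊗ h`. -/
def creation (k : Fin d) : Fock d V →ₗᵢ[ℂ] Fock d V := by
  have hinj : Function.Injective (List.cons k) := List.cons_injective
  have key : ∀ f : Fock d V, (fun α => ‖Function.extend (List.cons k) (⇑f) 0 α‖ ^ (2 : ℝ)) =
      Function.extend (List.cons k) (fun α => ‖f α‖ ^ (2 : ℝ)) 0 := by
    intro f
    funext α
    by_cases h : ∃ β, k :: β = α
    · obtain ⟨β, rfl⟩ := h
      rw [hinj.extend_apply, hinj.extend_apply]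
    · rw [Function.extend_apply' _ _ _ h, Function.extend_apply' _ _ _ h]
      simp
  have hs : ∀ f : Fock d V, Summable fun α => ‖f α‖ ^ (2 : ℝ) := fun f => by
    simpa using (lp.memℓp f).summable (p := 2) (by simp)
  exact
  { toFun := fun f => ⟨Function.extend (List.cons k) (⇑f) 0, memℓp_gen (by
      have := (hinj.summable_iff (f := Function.extend (List.cons k)
        (fun α => ‖f α‖ ^ (2 : ℝ)) 0) (fun x hx => by
          rw [Function.extend_apply' _ _ _ (by simpa using hx)]; rfl)).1 (by
          simpa [Function.comp_def, hinj.extend_apply] using hs f)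
      rw [← key] at this
      simpa using this)⟩
    map_add' := fun f g => by
      ext α
      change Function.extend (List.cons k) (⇑f + ⇑g) 0 α =
        Function.extend (List.cons k) (⇑f) 0 α + Function.extend (List.cons k) (⇑g) 0 α
      by_cases h : ∃ β, k :: β = α
      · obtain ⟨β, rfl⟩ := h
        simp only [Pi.add_apply, hinj.extend_apply]
      · simp [Function.extend_apply' _ _ _ h]
    map_smul' := fun c f => by
      ext α
      change Function.extend (List.cons k) (c • ⇑f) 0 α =
        c • Function.extend (List.cons k) (⇑f) 0 α
      by_cases h : ∃ β, k :: β = α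
      · obtain ⟨β, rfl⟩ := h
        simp only [Pi.smul_apply, hinj.extend_apply]
      · simp [Function.extend_apply' _ _ _ h]
    norm_map' := fun f => by
      rw [lp.norm_eq_tsum_rpow (by simp), lp.norm_eq_tsum_rpow (by simp)]
      congr 1
      simp only [ENNReal.toReal_ofNat]
      have := key f
      simp only [LinearMap.coe_mk, AddHom.coe_mk]
      rw [this, tsum_extend_zero hinj] }

theorem creation_apply_cons (k : Fin d) (f : Fock d V) (α : List (Fin d)) :
    creation k f (k :: α) = f α :=
  (List.cons_injective (a := k)).extend_apply (⇑f) 0 α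

theorem creation_apply_of_ne (k : Fin d) (f : Fock d V) (α : List (Fin d))
    (h : ¬ ∃ β, k :: β = α) : creation k f α = 0 :=
  Function.extend_apply' (f := List.cons k) (⇑f) 0 α h

/-- The backward left shift `L_k^* ⊗ I_V`. -/
def backShift [CompleteSpace V] (k : Fin d) : Fock d V →L[ℂ] Fock d V :=
  ContinuousLinearMap.adjoint (creation k).toContinuousLinearMap

end Fock

/-! ### Right Schur class -/

section Schur

variable {d : ℕ} {H J : Type*} [NormedAddCommGroup H] [InnerProductSpace ℂ H]
  [NormedAddCommGroup J] [InnerProductSpace ℂ J]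

/-- The right product `f(Z) •_R G(Z)`: matrices are multiplied in the order `f(Z) G(Z)`, and the
operator entries of `G(Z)` are applied to the vector entries of `f(Z)`. -/
def rightProd {n : ℕ} (F : Matrix (Fin n) (Fin n) H) (G : Matrix (Fin n) (Fin n) (H →L[ℂ] J)) :
    Matrix (Fin n) (Fin n) J :=
  Matrix.of fun i j => ∑ p, G p j (F i p)

/-- `G` respects intertwinings: `Z X = X W` implies `G(Z) X = X G(W)`. (Respecting the grading is
built into the type.) -/
def IsFreeFunction (G : ∀ n : ℕ, NCBall d n → Matrix (Fin n) (Fin n) (H →L[ℂ] J)) : Prop :=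
  ∀ (n m : ℕ) (Z : NCBall d n) (W : NCBall d m) (X : Matrix (Fin n) (Fin m) ℂ),
    (∀ k, Z.1 k * X = X * W.1 k) →
      ∀ i l, ∑ j, X j l • G n Z i j = ∑ k, X i k • G m W k l

end Schur

/-- The right free Schur class `𝓡_d(H, J)`: contractive right multipliers
`A = A(R) = M^R_{A^†(Z)}` from `H²(𝔹^d_ℕ) ⊗ H` to `H²(𝔹^d_ℕ) ⊗ J`. -/
structure RightSchur (d : ℕ) (H J : Type*) [NormedAddCommGroup H] [InnerProductSpace ℂ H]
    [NormedAddCommGroup J] [InnerProductSpace ℂ J] where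
  /-- the free function `A^†(Z) ∈ ℂ^{n×n} ⊗ 𝓛(H, J)` -/
  symbol : ∀ n : ℕ, NCBall d n → Matrix (Fin n) (Fin n) (H →L[ℂ] J)
  isFree : IsFreeFunction symbol
  /-- the operator `M^R_{A^†(Z)}` of right multiplication by `A^†` -/
  op : Fock d H →L[ℂ] Fock d J
  eval_op : ∀ (f : Fock d H) (n : ℕ) (Z : NCBall d n),
    eval (op f) Z = rightProd (eval f Z) (symbol n Z)
  norm_op_le : ‖op‖ ≤ 1

/-! ### The right free de Branges–Rovnyak kernel -/

section Kernel

variable {d : ℕ} {H J : Type*} [NormedAddCommGroup H] [InnerProductSpace ℂ H] [CompleteSpace H]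
  [NormedAddCommGroup J] [InnerProductSpace ℂ J] [CompleteSpace J]

/-- The free Szegő kernel `(K(Z, W) ⊗ I_J)[Q] = ∑_α Z^α Q (W^α)^*` acting on
`Q ∈ ℂ^{n×m} ⊗ 𝓛(J)`; here `(W^α)^* = (W^*)^{α^†}`. -/
def szego {n m : ℕ} (Z : NCBall d n) (W : NCBall d m)
    (Q : Matrix (Fin n) (Fin m) (J →L[ℂ] J)) : Matrix (Fin n) (Fin m) (J →L[ℂ] J) :=
  Matrix.of fun i k => ∑' α : List (Fin d),
    ∑ p, ∑ q, (Z.word α i p * (W.word α).conjTranspose q k) • Q p q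

/-- `P ⊗ I_J`. -/
def ampl {n m : ℕ} (P : Matrix (Fin n) (Fin m) ℂ) : Matrix (Fin n) (Fin m) (J →L[ℂ] J) :=
  Matrix.of fun p q => P p q • ContinuousLinearMap.id ℂ J

/-- `A^†(Z) (P ⊗ I_H) A^†(W)^*`. -/
def RightSchur.conj (A : RightSchur d H J) {n m : ℕ} (Z : NCBall d n) (W : NCBall d m)
    (P : Matrix (Fin n) (Fin m) ℂ) : Matrix (Fin n) (Fin m) (J →L[ℂ] J) :=
  Matrix.of fun p q => ∑ j, ∑ l, P j l •
    (A.symbol n Z p j ∘L ContinuousLinearMap.adjoint (A.symbol m W q l))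

/-- The right free de Branges–Rovnyak kernel
`K^A(Z, W)[P] = K(Z, W)[P] ⊗ I_J - (K(Z, W) ⊗ I_J)[A^†(Z) (P ⊗ I_H) A^†(W)^*]`. -/
def RightSchur.kernel (A : RightSchur d H J) {n m : ℕ} (Z : NCBall d n) (W : NCBall d m)
    (P : Matrix (Fin n) (Fin m) ℂ) : Matrix (Fin n) (Fin m) (J →L[ℂ] J) :=
  szego Z W (ampl P) - szego Z W (A.conj Z W P)

/-- The kernel `K^A` as a kernel in the matrix entries of free functions: with
`K^A{Z, y, v} g` the vector representing `f ↦ (y ⊗ g, f(Z) v)`, the inner product of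
`K^A{Z, e_i, e_j} g` and `K^A{W, e_k, e_l} g'` is `(e_i ⊗ g, K^A(Z, W)[e_j e_l^*] (e_k ⊗ g'))`. -/
def RightSchur.kernelMatrix (A : RightSchur d H J) :
    Matrix (NCPoint d) (NCPoint d) (J →L[ℂ] J) :=
  Matrix.of fun x y => A.kernel x.Z y.Z (Matrix.single x.j y.j 1) x.i y.i

/-! Positivity of the kernel. -/

theorem summable_sq (f : Fock d J) : Summable fun α => ‖f α‖ ^ 2 := by
  simpa using (lp.memℓp f).summable (p := 2) (by simp)

theorem summable_eval (f : Fock d J) {n : ℕ} (Z : NCBall d n) (i j : Fin n) :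
    Summable fun α => Z.word α i j • f α := by
  refine Summable.of_norm_bounded ((summable_word_sq Z i j).add (summable_sq f)) fun α => ?_
  rw [norm_smul]
  nlinarith [sq_nonneg (‖Z.word α i j‖ - ‖f α‖), sq_nonneg ‖Z.word α i j‖, sq_nonneg ‖f α‖]

theorem summable_mul_word {n m : ℕ} (Z : NCBall d n) (W : NCBall d m) (i p : Fin n)
    (q k : Fin m) : Summable fun α => Z.word α i p * (W.word α).conjTranspose q k := by
  refine Summable.of_norm_bounded ((summable_word_sq Z i p).add (summable_word_sq W k q))
    fun α => ?_
  rw [norm_mul, Matrix.conjTranspose_apply, norm_star]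
  nlinarith [sq_nonneg (‖Z.word α i p‖ - ‖W.word α k q‖), sq_nonneg ‖Z.word α i p‖,
    sq_nonneg ‖W.word α k q‖]

/-- The adjoint of the entry evaluation `f ↦ f(Z)_{ij}` on the Fock space. -/
def entryAdj {n : ℕ} (Z : NCBall d n) (i j : Fin n) (v : J) : Fock d J :=
  ⟨fun α => star (Z.word α i j) • v, memℓp_gen (by
    simpa [norm_smul, mul_pow] using (summable_word_sq Z i j).mul_right (‖v‖ ^ 2))⟩

theorem entryAdj_inner {n : ℕ} (Z : NCBall d n) (i j : Fin n) (v : J) (f : Fock d J) :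
    ⟪entryAdj Z i j v, f⟫_ℂ = ⟪v, eval f Z i j⟫_ℂ := by
  rw [lp.inner_eq_tsum]
  have h := (summable_eval f Z i j).hasSum.mapL (innerSL ℂ v)
  simp only [innerSL_apply_apply] at h
  rw [eval, Matrix.of_apply, ← h.tsum_eq]
  refine tsum_congr fun α => ?_
  change ⟪star (Z.word α i j) • v, f α⟫_ℂ = _
  rw [inner_smul_left, inner_smul_right]
  simp

theorem entryAdj_inner_entryAdj {n m : ℕ} (Z : NCBall d n) (W : NCBall d m) (i p : Fin n)
    (k q : Fin m) (b a : J) :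
    ⟪entryAdj W k q b, entryAdj Z i p a⟫_ℂ =
      star (∑' α, Z.word α i p * (W.word α).conjTranspose q k) * ⟪b, a⟫_ℂ := by
  rw [lp.inner_eq_tsum, tsum_star, ← tsum_mul_right]
  refine tsum_congr fun α => ?_
  change ⟪star (W.word α k q) • b, star (Z.word α i p) • a⟫_ℂ = _
  rw [inner_smul_left, inner_smul_right]
  simp
  ring

theorem szego_inner {n m : ℕ} (Z : NCBall d n) (W : NCBall d m)
    (Q : Matrix (Fin n) (Fin m) (J →L[ℂ] J)) (i : Fin n) (k : Fin m) (b a : J) :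
    ⟪szego Z W Q i k b, a⟫_ℂ = ∑ p, ∑ q,
      star (∑' α, Z.word α i p * (W.word α).conjTranspose q k) * ⟪Q p q b, a⟫_ℂ := by
  have h : szego Z W Q i k = ∑ p, ∑ q,
      (∑' α, Z.word α i p * (W.word α).conjTranspose q k) • Q p q := by
    have hs : ∀ p q, Summable fun α =>
        (Z.word α i p * (W.word α).conjTranspose q k) • Q p q := fun p q =>
      (summable_mul_word Z W i p q k).smul_const _
    rw [szego, Matrix.of_apply, Summable.tsum_finsetSum fun p _ => summable_sum fun q _ => hs p q]
    refine Finset.sum_congr rfl fun p _ => ?_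
    rw [Summable.tsum_finsetSum fun q _ => hs p q]
    exact Finset.sum_congr rfl fun q _ => (summable_mul_word Z W i p q k).tsum_smul_const _
  rw [h]
  simp [mul_comm]

theorem adjoint_op_entryAdj (A : RightSchur d H J) {n : ℕ} (Z : NCBall d n) (i j : Fin n)
    (b : J) : ContinuousLinearMap.adjoint A.op (entryAdj Z i j b) =
      ∑ p, entryAdj Z i p (ContinuousLinearMap.adjoint (A.symbol n Z p j) b) := by
  refine ext_inner_right ℂ fun f => ?_
  rw [ContinuousLinearMap.adjoint_inner_left, entryAdj_inner, A.eval_op, sum_inner]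
  simp [rightProd, entryAdj_inner, ContinuousLinearMap.adjoint_inner_left]

theorem kernelMatrix_inner (A : RightSchur d H J) (x y : NCPoint d) (b a : J) :
    ⟪A.kernelMatrix x y b, a⟫_ℂ = ⟪entryAdj y.Z y.i y.j b, entryAdj x.Z x.i x.j a⟫_ℂ -
      ⟪ContinuousLinearMap.adjoint A.op (entryAdj y.Z y.i y.j b),
        ContinuousLinearMap.adjoint A.op (entryAdj x.Z x.i x.j a)⟫_ℂ := by
  rw [RightSchur.kernelMatrix, Matrix.of_apply, RightSchur.kernel, Matrix.sub_apply,
    sub_apply, inner_sub_left, szego_inner, szego_inner]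
  congr 1
  · rw [entryAdj_inner_entryAdj, Finset.sum_eq_single x.j, Finset.sum_eq_single y.j]
    · simp [ampl]
    · intro q _ hq
      simp [ampl, Matrix.single_apply, Ne.symm hq]
    · simp
    · intro p _ hp
      simp [ampl, Matrix.single_apply, Ne.symm hp]
    · simp
  · rw [adjoint_op_entryAdj, adjoint_op_entryAdj]
    have hc : ∀ p q, A.conj x.Z y.Z (Matrix.single x.j y.j 1) p q =
        A.symbol x.n x.Z p x.j ∘L ContinuousLinearMap.adjoint (A.symbol y.n y.Z q y.j) := by
      intro p q
      rw [RightSchur.conj, Matrix.of_apply, Finset.sum_eq_single x.j, Finset.sum_eq_single y.j]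
      · simp
      · intro q _ hq
        simp [Ne.symm hq]
      · simp
      · intro p _ hp
        simp [Ne.symm hp]
      · simp
    simp only [hc, sum_inner, inner_sum, entryAdj_inner_entryAdj]
    refine Finset.sum_congr rfl fun p _ => ?_
    refine Finset.sum_congr rfl fun q _ => ?_
    rw [ContinuousLinearMap.comp_apply, ← ContinuousLinearMap.adjoint_inner_right]

theorem posSemidef_kernelMatrix (A : RightSchur d H J) : A.kernelMatrix.PosSemidef := by
  refine ((RKHS.posSemidef_tfae (K := A.kernelMatrix)).out 0 2).mpr ?_
  refine ⟨?_, fun vv => ?_⟩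
  · ext x y b
    refine ext_inner_right ℂ fun a => ?_
    rw [Matrix.conjTranspose_apply, ContinuousLinearMap.star_eq_adjoint,
      ContinuousLinearMap.adjoint_inner_left, ← inner_conj_symm, kernelMatrix_inner,
      kernelMatrix_inner, map_sub, inner_conj_symm, inner_conj_symm]
  · have hF : (vv.sum fun x w => vv.sum fun x' w' => ⟪A.kernelMatrix x' x w, w'⟫_ℂ) =
        ⟪vv.sum fun x w => entryAdj x.Z x.i x.j w, vv.sum fun x w => entryAdj x.Z x.i x.j w⟫_ℂ -
        ⟪ContinuousLinearMap.adjoint A.op (vv.sum fun x w => entryAdj x.Z x.i x.j w),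
          ContinuousLinearMap.adjoint A.op (vv.sum fun x w => entryAdj x.Z x.i x.j w)⟫_ℂ := by
      simp only [Finsupp.sum, map_sum, sum_inner, inner_sum, kernelMatrix_inner,
        Finset.sum_sub_distrib]
      congr 1 <;> exact Finset.sum_comm
    rw [hF, map_sub, inner_self_eq_norm_sq, inner_self_eq_norm_sq, sub_nonneg]
    have h1 : ‖ContinuousLinearMap.adjoint A.op‖ ≤ 1 := by
      rw [LinearIsometryEquiv.norm_map]
      exact A.norm_op_le
    have h2 := (ContinuousLinearMap.adjoint A.op).le_of_opNorm_le h1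
      (vv.sum fun x w => entryAdj x.Z x.i x.j w)
    rw [one_mul] at h2
    gcongr

instance (A : RightSchur d H J) : Fact A.kernelMatrix.PosSemidef := ⟨posSemidef_kernelMatrix A⟩

end Kernel

/-! ### The right free de Branges–Rovnyak space and the operators on it -/

section Space

variable {d : ℕ} {H J : Type*} [NormedAddCommGroup H] [InnerProductSpace ℂ H] [CompleteSpace H]
  [NormedAddCommGroup J] [InnerProductSpace ℂ J] [CompleteSpace J]

/-- The right free de Branges–Rovnyak space `𝓗^R(A)`, the reproducing kernel Hilbert space of
`J`-valued functions on the NC ball with kernel `K^A`. For `F` in it and `x = (n, Z, i, j)`, the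
vector `F x ∈ J` is the entry `F(Z)_{ij}`. -/
def RightSchur.HR (A : RightSchur d H J) : Type _ := RKHS.OfKernel A.kernelMatrix

instance (A : RightSchur d H J) : NormedAddCommGroup A.HR :=
  inferInstanceAs (NormedAddCommGroup (RKHS.OfKernel A.kernelMatrix))

instance (A : RightSchur d H J) : InnerProductSpace ℂ A.HR :=
  inferInstanceAs (InnerProductSpace ℂ (RKHS.OfKernel A.kernelMatrix))

instance (A : RightSchur d H J) : CompleteSpace A.HR :=
  inferInstanceAs (CompleteSpace (RKHS.OfKernel A.kernelMatrix))

instance (A : RightSchur d H J) : RKHS ℂ A.HR (NCPoint d) J :=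
  inferInstanceAs (RKHS ℂ (RKHS.OfKernel A.kernelMatrix) (NCPoint d) J)

theorem RightSchur.kernel_HR (A : RightSchur d H J) : RKHS.kernel A.HR = A.kernelMatrix :=
  RKHS.OfKernel.kernel_ofKernel

/-- The point `0 ∈ 𝔹^d_1`. -/
def NCPoint.zero (d : ℕ) : NCPoint d := ⟨1, NCBall.zero d 1, 0, 0⟩

/-- `A(0) ∈ 𝓛(H, J)`. -/
def RightSchur.atZero (A : RightSchur d H J) : H →L[ℂ] J := A.symbol 1 (NCBall.zero d 1) 0 0

/-- `K_0^A : J → 𝓗^R(A)`, the adjoint of the evaluation `F ↦ F(0)`. -/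
def RightSchur.K0 (A : RightSchur d H J) : J →L[ℂ] A.HR := RKHS.kerFun A.HR (NCPoint.zero d)

/-- `𝓗^R(A) ⊗ ℂ^d`. -/
abbrev RightSchur.HRd (A : RightSchur d H J) : Type _ := PiLp 2 fun _ : Fin d => A.HR

/-- `X = (L^* ⊗ I_J)|_{𝓗^R(A)}`: every `F ∈ 𝓗^R(A)` is the function of a (unique) `f ∈ F²_d ⊗ J`,
and `X_k F` is the function of `L_k^* f`. -/
def RightSchur.IsRestrictedBackShift (A : RightSchur d H J) (X : A.HR →L[ℂ] A.HRd) : Prop :=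
  ∀ F : A.HR, ∃ f : Fock d J, (∀ x : NCPoint d, F x = eval f x.Z x.i x.j) ∧
    ∀ (k : Fin d) (x : NCPoint d), X F k x = eval (backShift k f) x.Z x.i x.j

/-- `𝐀 = (L^* ⊗ I_J) A`: `𝐀_k h` is the function of `L_k^* A (1 ⊗ h)`. -/
def RightSchur.IsGleason (A : RightSchur d H J) (T : H →L[ℂ] A.HRd) : Prop :=
  ∀ (h : H) (k : Fin d) (x : NCPoint d),
    T h k x = eval (backShift k (A.op (vac h))) x.Z x.i x.j

/-- `𝓓_A`, the space of all `h ∈ H` such that the function `(A h)(Z) = A^†(Z) (I_n ⊗ h)` belongs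
to `𝓗^R(A)`. -/
def RightSchur.dom (A : RightSchur d H J) : Submodule ℂ H where
  carrier := {h | ∃ F : A.HR, ∀ x : NCPoint d, F x = A.symbol x.n x.Z x.i x.j h}
  add_mem' := by
    rintro g h ⟨F, hF⟩ ⟨G, hG⟩
    exact ⟨F + G, fun x => by simp [hF, hG]⟩
  zero_mem' := ⟨0, fun x => by simp⟩
  smul_mem' := by
    rintro c h ⟨F, hF⟩
    exact ⟨c • F, fun x => by simp [hF]⟩

/-- The operator `Â : H ⊇ 𝓓_A → 𝓗^R(A)`, `Â h = A h`. -/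
def RightSchur.hat (A : RightSchur d H J) : H →ₗ.[ℂ] A.HR where
  domain := A.dom
  toFun :=
    { toFun := fun h => h.2.choose
      map_add' := fun g h => by
        refine RKHS.ext fun x => ?_
        rw [(g + h).2.choose_spec x, RKHS.coe_add, Pi.add_apply, g.2.choose_spec x,
          h.2.choose_spec x]
        simp
      map_smul' := fun c h => by
        refine RKHS.ext fun x => ?_
        rw [(c • h).2.choose_spec x, RingHom.id_apply, RKHS.coe_smul, Pi.smul_apply,
          h.2.choose_spec x]
        simp }

theorem RightSchur.hat_apply (A : RightSchur d H J) (h : A.dom) (x : NCPoint d) :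
    (A.hat h : A.HR) x = A.symbol x.n x.Z x.i x.j h :=
  h.2.choose_spec x

/-- `Â` viewed as a (densely defined) operator in the Hilbert space `closure 𝓓_A`. -/
def RightSchur.hatCl (A : RightSchur d H J) : A.dom.topologicalClosure →ₗ.[ℂ] A.HR where
  domain := A.dom.comap A.dom.topologicalClosure.subtype
  toFun := A.hat.toFun ∘ₗ
    (A.dom.topologicalClosure.subtype.restrict (p := A.dom.comap A.dom.topologicalClosure.subtype)
      (q := A.dom) fun _ hx => hx)

end Space

open scoped LinearPMap in
/-- `T^* T` for a densely defined operator `T`, on its natural domain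
`{x ∈ Dom T | T x ∈ Dom T^*}`. -/
def adjMulSelf {E F : Type*} [NormedAddCommGroup E] [InnerProductSpace ℂ E] [CompleteSpace E]
    [NormedAddCommGroup F] [InnerProductSpace ℂ F] (T : E →ₗ.[ℂ] F) : E →ₗ.[ℂ] E :=
  T†.comp (T.domRestrict ((T†.domain.comap T.toFun).map T.domain.subtype)) (by
    rintro ⟨x, hx, hx'⟩
    obtain ⟨y, hy, rfl⟩ := hx
    exact hy)

end FreeDBR

end

/-! Let `U = [X, 𝐀; K_0^*, A(0)]`, acting from `𝓗^R(A) ⊕ H` to `(𝓗^R(A) ⊗ ℂ^d) ⊕ J`. The proof rests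
on two facts: `U` is a coisometry (`RightSchur.isCoisometricColligation`), and its kernel is the
graph of `Â` up to a sign, namely all `(Âh, -h)` (`RightSchur.mem_hat_graph_iff`). Hence `I - U^*U`
is the orthogonal projection onto that graph. Its `H`-corner is `a_∅²`, its `𝓗^R(A)`-corner is `I -
X^*X - K_0 K_0^*`, and its off-diagonal part is minus `X^*𝐀 + K_0 A(0)` (`cross`) and its adjoint.

The four assertions are von Neumann's description of a closed operator through the projection on its
graph. Restricted to the closure of `𝓓_A`, the corner `a_∅²` is the resolvent `(I + Â^*Â)⁻¹`
(`inverse_id_vadd_adjMulSelf`). Douglas factorization gives `cross = B a_∅` with `B = Â a_∅` bounded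
(`exists_factor`), whence `ran a_∅ ⊆ 𝓓_A`; the reverse inclusion and `BB^*` come from the remaining
block identities.

Coisometry comes from the Fock space. `𝓗^R(A)` embeds contractively by a map `ι` with `ι ι^* = I - A
A^*` (`RightSchur.incl_adjoint_incl`), and `A` commutes with the left creation operators, being a
right multiplier. So `A^* L_k u` is `L_k A^* u` plus a vacuum term, which yields both the
boundedness of `X` and `𝐀` (`RightSchur.exists_lift`) and the block identities of `U U^* = I`. -/

namespace FreeDBR

/-! ### Factorization of operators -/

section Factorization

variable {E H G : Type*} [AddCommGroup E] [Module ℂ E]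
  [NormedAddCommGroup H] [InnerProductSpace ℂ H] [CompleteSpace H]
  [NormedAddCommGroup G] [InnerProductSpace ℂ G] [CompleteSpace G]

/-- Douglas factorization: if `‖Q x‖ ≤ ‖S x‖`, then `Q` factors through `S`. -/
theorem exists_clm_comp_eq (S : E →ₗ[ℂ] H) (Q : E →ₗ[ℂ] G) (h : ∀ x, ‖Q x‖ ≤ ‖S x‖) :
    ∃ B : H →L[ℂ] G, (∀ x, B (S x) = Q x) ∧ ∀ y ∈ (LinearMap.range S)ᗮ, B y = 0 := by
  set K := (LinearMap.range S).topologicalClosure with hK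
  have hmem : ∀ x, S x ∈ K := fun x => Submodule.le_topologicalClosure _ ⟨x, rfl⟩
  have : CompleteSpace K := (Submodule.isClosed_topologicalClosure _).completeSpace_coe
  set S' : E →ₗ[ℂ] K := S.codRestrict K hmem with hS'
  have hd : DenseRange S' := by
    intro y
    rw [closure_subtype]
    have h1 : (Subtype.val '' Set.range S' : Set H) = Set.range S := by
      rw [← Set.range_comp]
      rfl
    rw [h1]
    exact y.2
  have hn : ∀ x, ‖Q x‖ ≤ 1 * ‖S' x‖ := fun x => by simpa using! h x
  -- The map `S x ↦ Q x` extends to the closure of the range; precomposing with the projection makes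
  -- it vanish on the complement.
  refine ⟨Q.extendOfNorm S' ∘L K.orthogonalProjectionOnto, fun x => ?_, fun y hy => ?_⟩
  · have h1 : K.orthogonalProjectionOnto (S x) = S' x :=
      Submodule.orthogonalProjectionOnto_mem_subspace_eq_self (K := K) (S' x)
    rw [ContinuousLinearMap.comp_apply, h1, LinearMap.extendOfNorm_eq hd ⟨1, hn⟩]
  · have h1 : y ∈ Kᗮ := by rwa [hK, Submodule.orthogonal_closure]
    rw [ContinuousLinearMap.comp_apply,
      Submodule.orthogonalProjectionOnto_eq_zero_iff.2 h1, map_zero]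

/-- Agreement passes to the closure of the range by continuity, and this closure and its orthogonal
complement span `H`. It serves to cancel a factor `a` on the right. -/
theorem clm_ext_range {S S' : H →L[ℂ] G} (a : H →L[ℂ] H) (h : ∀ x, S (a x) = S' (a x))
    (h0 : ∀ y ∈ (LinearMap.range (a : H →ₗ[ℂ] H))ᗮ, S y = S' y) : S = S' := by
  set K := (LinearMap.range (a : H →ₗ[ℂ] H)).topologicalClosure with hK
  have : CompleteSpace K := (Submodule.isClosed_topologicalClosure _).completeSpace_coe
  have h1 : K ≤ LinearMap.eqLocus (S : H →ₗ[ℂ] G) (S' : H →ₗ[ℂ] G) := by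
    refine Submodule.topologicalClosure_minimal _ ?_ (isClosed_eq S.continuous S'.continuous)
    rintro _ ⟨x, rfl⟩
    exact h x
  ext x
  obtain ⟨y, hy, z, hz, rfl⟩ := Submodule.exists_add_mem_mem_orthogonal (K := K) x
  rw [hK, Submodule.orthogonal_closure] at hz
  rw [map_add, map_add, h0 z hz]
  congr 1
  exact h1 hy

theorem exists_isPositive_sqrt {R : H →L[ℂ] H} (h : R.IsPositive) :
    ∃ a : H →L[ℂ] H, a.IsPositive ∧ a ∘L a = R := by
  rw [← ContinuousLinearMap.nonneg_iff_isPositive] at h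
  exact ⟨CFC.sqrt R, (ContinuousLinearMap.nonneg_iff_isPositive _).1 (CFC.sqrt_nonneg R),
    CFC.sqrt_mul_sqrt_self R h⟩

end Factorization

/-! ### The resolvent of `T^* T` from the projection on the graph of `T` -/

section AdjMulSelf

open scoped LinearPMap

variable {E F : Type*} [NormedAddCommGroup E] [InnerProductSpace ℂ E] [CompleteSpace E]
  [NormedAddCommGroup F] [InnerProductSpace ℂ F]

theorem mem_adjMulSelf_domain (T : E →ₗ.[ℂ] F) (h : E) :
    h ∈ (adjMulSelf T).domain ↔ ∃ hx : h ∈ T.domain, T ⟨h, hx⟩ ∈ T†.domain := by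
  change h ∈ ((T†.domain.comap T.toFun).map T.domain.subtype) ⊓ T.domain ↔ _
  constructor
  · rintro ⟨⟨y, hy, rfl⟩, -⟩
    exact ⟨y.2, hy⟩
  · rintro ⟨hx, hy⟩
    exact ⟨⟨⟨h, hx⟩, hy, rfl⟩, hx⟩

theorem adjMulSelf_apply (T : E →ₗ.[ℂ] F) (h : (adjMulSelf T).domain) (hx : (h : E) ∈ T.domain)
    (hy : T ⟨h, hx⟩ ∈ T†.domain) : adjMulSelf T h = T† ⟨T ⟨h, hx⟩, hy⟩ := rfl

variable {T : E →ₗ.[ℂ] F}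

/-- Pairing the equation with `h` gives `‖h‖² + ‖T h‖² = 0`. -/
theorem id_vadd_adjMulSelf_injective (hT : Dense (T.domain : Set E)) {h : E}
    (hh : h ∈ (adjMulSelf T).domain) (h0 : h + adjMulSelf T ⟨h, hh⟩ = 0) : h = 0 := by
  obtain ⟨hx, hy⟩ := (mem_adjMulSelf_domain T h).1 hh
  rw [adjMulSelf_apply T ⟨h, hh⟩ hx hy] at h0
  have h1 := LinearPMap.adjoint_isFormalAdjoint hT ⟨T ⟨h, hx⟩, hy⟩ ⟨h, hx⟩
  have h2 : ⟪h + T† ⟨T ⟨h, hx⟩, hy⟩, h⟫_ℂ = 0 := by rw [h0, inner_zero_left]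
  rw [inner_add_left, h1, inner_self_eq_norm_sq_to_K, inner_self_eq_norm_sq_to_K] at h2
  have h3 : ‖h‖ ^ 2 + ‖T ⟨h, hx⟩‖ ^ 2 = 0 := Complex.ofReal_injective (by push_cast; exact h2)
  have h4 : ‖h‖ ^ 2 = 0 := by nlinarith [sq_nonneg ‖h‖, sq_nonneg ‖T ⟨h, hx⟩‖]
  simpa using h4

variable {S : E →L[ℂ] E} {Q : E → F}

/-- If `(S g, Q g)` is the orthogonal projection of `(g, 0)` on the graph of `T`, then
`(I + T^* T) S = I`. -/
theorem exists_adjMulSelf_apply_eq (hT : Dense (T.domain : Set E))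
    (hmem : ∀ g, (S g, Q g) ∈ T.graph)
    (hinner : ∀ g v w, (v, w) ∈ T.graph → ⟪Q g, w⟫_ℂ = ⟪g - S g, v⟫_ℂ) (g : E) :
    ∃ hg : S g ∈ (adjMulSelf T).domain, adjMulSelf T ⟨S g, hg⟩ = g - S g := by
  obtain ⟨⟨x, hx⟩, rfl, h2⟩ := (LinearPMap.mem_graph_iff _).1 (hmem g)
  simp only at h2
  -- Orthogonality of `(g - S g, -Q g)` to the graph: `g - S g` represents `x ↦ ⟪Q g, T x⟫`, so it
  -- is `T†` of `Q g = T (S g)`.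
  have h3 : ∀ x : T.domain, ⟪g - S g, (x : E)⟫_ℂ = ⟪Q g, T x⟫_ℂ := fun x =>
    (hinner g _ _ (T.mem_graph x)).symm
  have hy : T ⟨S g, hx⟩ ∈ T†.domain := by
    rw [h2]
    exact LinearPMap.mem_adjoint_domain_of_exists _ ⟨_, h3⟩
  refine ⟨(mem_adjMulSelf_domain T _).2 ⟨hx, hy⟩, ?_⟩
  rw [adjMulSelf_apply T _ hx hy]
  refine LinearPMap.adjoint_apply_eq hT _ fun x => ?_
  rw [h3]
  simp only [h2]

/-- A right inverse of an injective map is also a left inverse. -/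
theorem apply_add_adjMulSelf (hT : Dense (T.domain : Set E))
    (hmem : ∀ g, (S g, Q g) ∈ T.graph)
    (hinner : ∀ g v w, (v, w) ∈ T.graph → ⟪Q g, w⟫_ℂ = ⟪g - S g, v⟫_ℂ)
    (h : (adjMulSelf T).domain) : S (h + adjMulSelf T h) = h := by
  obtain ⟨hg, h1⟩ := exists_adjMulSelf_apply_eq hT hmem hinner (h + adjMulSelf T h)
  have h2 : S (h + adjMulSelf T h) - h = 0 := by
    refine id_vadd_adjMulSelf_injective hT (Submodule.sub_mem _ hg h.2) ?_
    have h3 := (adjMulSelf T).map_sub ⟨_, hg⟩ h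
    have h4 : (⟨S (h + adjMulSelf T h) - h, Submodule.sub_mem _ hg h.2⟩ : (adjMulSelf T).domain) =
      ⟨_, hg⟩ - h := rfl
    rw [h4, h3, h1]
    abel
  exact sub_eq_zero.1 h2

theorem ker_id_vadd_adjMulSelf (hT : Dense (T.domain : Set E)) :
    LinearMap.ker ((LinearMap.id : E →ₗ[ℂ] E) +ᵥ adjMulSelf T).toFun = ⊥ := by
  rw [Submodule.eq_bot_iff]
  rintro ⟨h, hh⟩ h0
  exact Subtype.ext (id_vadd_adjMulSelf_injective hT hh h0)

theorem inverse_id_vadd_adjMulSelf (hT : Dense (T.domain : Set E))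
    (hmem : ∀ g, (S g, Q g) ∈ T.graph)
    (hinner : ∀ g v w, (v, w) ∈ T.graph → ⟪Q g, w⟫_ℂ = ⟪g - S g, v⟫_ℂ) :
    ((LinearMap.id : E →ₗ[ℂ] E) +ᵥ adjMulSelf T).inverse = (S : E →ₗ[ℂ] E).toPMap ⊤ := by
  have hker := ker_id_vadd_adjMulSelf hT
  have hval : ∀ g, ∃ x : ((LinearMap.id : E →ₗ[ℂ] E) +ᵥ adjMulSelf T).domain,
      (x : E) = S g ∧ ((LinearMap.id : E →ₗ[ℂ] E) +ᵥ adjMulSelf T) x = g := by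
    intro g
    obtain ⟨hg, h1⟩ := exists_adjMulSelf_apply_eq hT hmem hinner g
    refine ⟨⟨S g, hg⟩, rfl, ?_⟩
    change S g + adjMulSelf T ⟨S g, hg⟩ = g
    rw [h1]
    abel
  refine LinearPMap.ext ?_ ?_
  · rw [LinearPMap.inverse_domain, LinearMap.toPMap_domain, eq_top_iff]
    rintro g -
    obtain ⟨x, -, hx⟩ := hval g
    exact ⟨x, hx⟩
  · intro g hg hg'
    obtain ⟨x, hx, hx'⟩ := hval g
    rw [LinearPMap.inverse_apply_eq hker (x := x) hx', hx]
    rfl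

end AdjMulSelf

/-! ### Coisometric colligations -/

section Colligation

open ContinuousLinearMap

variable {H J M G : Type*}
  [NormedAddCommGroup H] [InnerProductSpace ℂ H] [CompleteSpace H]
  [NormedAddCommGroup J] [InnerProductSpace ℂ J] [CompleteSpace J]
  [NormedAddCommGroup M] [InnerProductSpace ℂ M] [CompleteSpace M]
  [NormedAddCommGroup G] [InnerProductSpace ℂ G] [CompleteSpace G]

/-- The block operator `[X, T; K^*, C] : M ⊕ H → G ⊕ J` is a coisometry. -/
structure IsCoisometricColligation (X : M →L[ℂ] G) (T : H →L[ℂ] G) (K : J →L[ℂ] M)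
    (C : H →L[ℂ] J) : Prop where
  state : ∀ g, X (adjoint X g) + T (adjoint T g) = g
  mixed : ∀ j, X (K j) + T (adjoint C j) = 0
  output : ∀ j, adjoint K (K j) + C (adjoint C j) = j

namespace IsCoisometricColligation

variable {X : M →L[ℂ] G} {T : H →L[ℂ] G} {K : J →L[ℂ] M} {C : H →L[ℂ] J}

/-- The remaining off-diagonal block of `U U^* = I`, adjoint to `mixed`. -/
theorem mixed_adjoint (hU : IsCoisometricColligation X T K C) (g : G) :
    adjoint K (adjoint X g) + C (adjoint T g) = 0 := by
  refine ext_inner_right ℂ fun j => ?_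
  have h := congrArg (fun x => ⟪g, x⟫_ℂ) (hU.mixed j)
  simp only [inner_add_right, inner_zero_right] at h
  rw [inner_add_left, inner_zero_left, adjoint_inner_left, adjoint_inner_left,
    ← adjoint_inner_right C, adjoint_inner_left, h]

variable (T C) in
/-- The defect `I - C^* C - T^* T`. -/
noncomputable def defect : H →L[ℂ] H :=
  ContinuousLinearMap.id ℂ H - adjoint C ∘L C - adjoint T ∘L T

variable (X T K C) in
/-- The off-diagonal entry `X^* T + K C`. -/
noncomputable def cross : H →L[ℂ] M := adjoint X ∘L T + K ∘L C

theorem sub_defect (h : H) : h - defect T C h = adjoint C (C h) + adjoint T (T h) := by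
  simp only [defect, sub_apply, id_apply, comp_apply]
  abel

/-- The defect is a diagonal corner of the projection `I - U^*U`; the argument is carried out on
vectors, without forming the direct sum. -/
theorem isPositive_defect (hU : IsCoisometricColligation X T K C) : (defect T C).IsPositive := by
  rw [isPositive_def']
  constructor
  · rw [ContinuousLinearMap.isSelfAdjoint_iff', defect]
    simp only [map_sub, adjoint_comp, adjoint_adjoint, adjoint_id]
  · intro h
    -- `(z, w) = U^*U (0, h)`. Below, `e1` and `e2` are the two rows of `U (z, w) = U (0, h)`, and
    -- `h2` is idempotence of `U^*U`.
    set w := adjoint C (C h) + adjoint T (T h) with hw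
    set z := adjoint X (T h) + K (C h) with hz
    have h2 : ⟪w, w⟫_ℂ + ⟪z, z⟫_ℂ = ⟪w, h⟫_ℂ := by
      have e1 : C w + adjoint K z = C h := by
        have := hU.output (C h)
        have h' := hU.mixed_adjoint (T h)
        rw [hw, hz, map_add, map_add]
        calc _ = (adjoint K (K (C h)) + C (adjoint C (C h))) +
              (adjoint K (adjoint X (T h)) + C (adjoint T (T h))) := by abel
          _ = _ := by rw [this, h', add_zero]
      have e2 : T w + X z = T h := by
        have := hU.state (T h)
        have h' := hU.mixed (C h)
        rw [hw, hz, map_add, map_add]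
        calc _ = (X (adjoint X (T h)) + T (adjoint T (T h))) +
              (X (K (C h)) + T (adjoint C (C h))) := by abel
          _ = _ := by rw [this, h', add_zero]
      have e3 : ⟪w, w⟫_ℂ = ⟪C h, C w⟫_ℂ + ⟪T h, T w⟫_ℂ := by
        nth_rw 1 [hw]
        rw [inner_add_left, adjoint_inner_left, adjoint_inner_left]
      have e4 : ⟪z, z⟫_ℂ = ⟪T h, X z⟫_ℂ + ⟪C h, adjoint K z⟫_ℂ := by
        nth_rw 1 [hz]
        rw [inner_add_left, adjoint_inner_left, adjoint_inner_right]
      have e5 : ⟪w, h⟫_ℂ = ⟪C h, C h⟫_ℂ + ⟪T h, T h⟫_ℂ := by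
        rw [hw, inner_add_left, adjoint_inner_left, adjoint_inner_left]
      have e6 : ⟪C h, C w⟫_ℂ + ⟪C h, adjoint K z⟫_ℂ = ⟪C h, C h⟫_ℂ := by
        rw [← inner_add_right, e1]
      have e7 : ⟪T h, T w⟫_ℂ + ⟪T h, X z⟫_ℂ = ⟪T h, T h⟫_ℂ := by
        rw [← inner_add_right, e2]
      rw [e5, e3, e4]
      linear_combination e6 + e7
    have h3 : ‖w‖ ^ 2 ≤ (⟪w, h⟫_ℂ).re := by
      rw [← h2, inner_self_eq_norm_sq_to_K, inner_self_eq_norm_sq_to_K]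
      have : ‖w‖ ^ 2 + ‖z‖ ^ 2 = (((‖w‖ : ℂ) ^ 2 + (‖z‖ : ℂ) ^ 2).re) := by
        norm_cast
      have hz0 := sq_nonneg ‖z‖
      change ‖w‖ ^ 2 ≤ ((‖w‖ : ℂ) ^ 2 + (‖z‖ : ℂ) ^ 2).re
      linarith
    have h4 : (⟪w, h⟫_ℂ).re ≤ ‖w‖ * ‖h‖ := re_inner_le_norm (𝕜 := ℂ) w h
    have h5 : defect T C h = h - w := by rw [hw, ← sub_defect]; abel
    rw [reApplyInnerSelf_apply, h5, inner_sub_left, map_sub, inner_self_eq_norm_sq]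
    change 0 ≤ ‖h‖ ^ 2 - (⟪w, h⟫_ℂ).re
    -- `Re ⟪w, h⟫ ≤ ‖w‖‖h‖ ≤ (‖w‖² + ‖h‖²)/2 ≤ (Re ⟪w, h⟫ + ‖h‖²)/2`.
    nlinarith [norm_nonneg w, norm_nonneg h, sq_nonneg (‖w‖ - ‖h‖)]

/-- First row of `U (I - U^*U) = 0` on `(0, h)`; `adjoint_apply_cross` is the second. Together they
put `(cross h, -defect h)` in `ker U`. -/
theorem apply_cross (hU : IsCoisometricColligation X T K C) (h : H) :
    X (cross X T K C h) = T (defect T C h) := by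
  have h1 := hU.state (T h)
  have h2 := hU.mixed (C h)
  have h3 : X (adjoint X (T h)) = T h - T (adjoint T (T h)) := eq_sub_of_add_eq h1
  have h4 : X (K (C h)) = - T (adjoint C (C h)) := eq_neg_of_add_eq_zero_left h2
  simp only [cross, defect, add_apply, sub_apply, comp_apply, id_apply, map_add, map_sub, h3, h4]
  abel

theorem adjoint_apply_cross (hU : IsCoisometricColligation X T K C) (h : H) :
    adjoint K (cross X T K C h) = C (defect T C h) := by
  have h3 : adjoint K (adjoint X (T h)) = - C (adjoint T (T h)) :=
    eq_neg_of_add_eq_zero_left (hU.mixed_adjoint (T h))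
  have h4 : adjoint K (K (C h)) = C h - C (adjoint C (C h)) := eq_sub_of_add_eq (hU.output (C h))
  simp only [cross, defect, add_apply, sub_apply, comp_apply, id_apply, map_add, map_sub, h3, h4]
  abel

theorem adjoint_cross_apply (F : M) : adjoint (cross X T K C) F =
    adjoint T (X F) + adjoint C (adjoint K F) := by
  simp [cross, adjoint_comp, map_add]

/-- The same identity `U (I - U^*U) = 0`, now on `(F, 0)`; `adjoint_apply_stateDefect` is its second
row. -/
theorem apply_stateDefect (hU : IsCoisometricColligation X T K C) (F : M) :
    X (F - adjoint X (X F) - K (adjoint K F)) = T (adjoint (cross X T K C) F) := by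
  have h3 : X (adjoint X (X F)) = X F - T (adjoint T (X F)) := eq_sub_of_add_eq (hU.state _)
  have h4 : X (K (adjoint K F)) = - T (adjoint C (adjoint K F)) :=
    eq_neg_of_add_eq_zero_left (hU.mixed _)
  rw [adjoint_cross_apply]
  simp only [map_add, map_sub, h3, h4]
  abel

theorem adjoint_apply_stateDefect (hU : IsCoisometricColligation X T K C) (F : M) :
    adjoint K (F - adjoint X (X F) - K (adjoint K F)) = C (adjoint (cross X T K C) F) := by
  have h3 : adjoint K (adjoint X (X F)) = - C (adjoint T (X F)) :=
    eq_neg_of_add_eq_zero_left (hU.mixed_adjoint _)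
  have h4 : adjoint K (K (adjoint K F)) = adjoint K F - C (adjoint C (adjoint K F)) :=
    eq_sub_of_add_eq (hU.output _)
  rw [adjoint_cross_apply]
  simp only [map_add, map_sub, h3, h4]
  abel

/-- The hypotheses say `(F, -v) ∈ ker U`, which is orthogonal to `U^*U (0, h) = (cross h, h - defect
h)`. -/
theorem inner_cross (h v : H) (F : M) (hX : X F = T v) (hK : adjoint K F = C v) :
    ⟪cross X T K C h, F⟫_ℂ = ⟪h - defect T C h, v⟫_ℂ := by
  rw [sub_defect, ← adjoint_inner_right, adjoint_cross_apply, hX, hK, inner_add_right,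
    inner_add_left, adjoint_inner_right, adjoint_inner_right, adjoint_inner_left,
    adjoint_inner_left, add_comm]

/-- With `a` the square root of the defect, `X^* T + K C = B a` for an operator `B` with
`X B = T a` and `K^* B = C a`. -/
theorem exists_factor (hU : IsCoisometricColligation X T K C) {a : H →L[ℂ] H}
    (ha : a.IsPositive) (haa : a ∘L a = defect T C) : ∃ B : H →L[ℂ] M,
      B ∘L a = cross X T K C ∧ (∀ h, X (B h) = T (a h)) ∧ ∀ h, adjoint K (B h) = C (a h) := by
  have hs : ∀ x y, ⟪a x, y⟫_ℂ = ⟪x, a y⟫_ℂ := fun x y => ha.isSymmetric x y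
  have haa' : ∀ h, a (a h) = defect T C h := fun h => by rw [← haa]; rfl
  -- Pairing with the kernel vector `(cross h, -defect h)` gives `‖cross h‖² = ‖a h‖² - ‖a (a h)‖²`,
  -- the bound that Douglas factorization needs.
  have hn : ∀ h, ‖cross X T K C h‖ ≤ ‖a h‖ := by
    intro h
    have h1 := inner_cross h (defect T C h) (cross X T K C h) (hU.apply_cross h)
      (hU.adjoint_apply_cross h)
    rw [inner_sub_left, ← haa', ← hs, inner_self_eq_norm_sq_to_K, inner_self_eq_norm_sq_to_K,
      inner_self_eq_norm_sq_to_K] at h1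
    have h2 : ‖cross X T K C h‖ ^ 2 = ‖a h‖ ^ 2 - ‖a (a h)‖ ^ 2 := by exact_mod_cast h1
    exact (sq_le_sq₀ (norm_nonneg _) (norm_nonneg _)).1 (by nlinarith [sq_nonneg ‖a (a h)‖])
  obtain ⟨B, hB, hB0⟩ := exists_clm_comp_eq (a : H →ₗ[ℂ] H) (cross X T K C : H →ₗ[ℂ] M) hn
  have hB' : ∀ h, B (a h) = cross X T K C h := hB
  have ha0 : ∀ y ∈ (LinearMap.range (a : H →ₗ[ℂ] H))ᗮ, a y = 0 := by
    intro y hy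
    refine ext_inner_left ℂ fun x => ?_
    rw [inner_zero_right, ← hs]
    exact hy _ ⟨x, rfl⟩
  refine ⟨B, ContinuousLinearMap.ext hB', fun h => ?_, fun h => ?_⟩
  -- Both sides agree on `ran a` by `apply_cross` and vanish on its orthogonal complement.
  · exact DFunLike.congr_fun (clm_ext_range (S := X ∘L B) (S' := T ∘L a) a
      (fun h => by simp [hB', haa', hU.apply_cross])
      (fun y hy => by simp [ha0 y hy, hB0 y hy])) h
  · exact DFunLike.congr_fun (clm_ext_range (S := adjoint K ∘L B) (S' := C ∘L a) a
      (fun h => by simp [hB', haa', hU.adjoint_apply_cross])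
      (fun y hy => by simp [ha0 y hy, hB0 y hy])) h

end IsCoisometricColligation

end Colligation

/-! ### Separation of elements of the Fock space by their values -/

section Separation

variable {d : ℕ}

/-- The matrices of the compressed backward shift along a word. -/
noncomputable def pathMatrix (α : List (Fin d)) (k : Fin d) :
    Matrix (Fin (α.length + 1)) (Fin (α.length + 1)) ℂ :=
  Matrix.of fun p q => if (q : ℕ) = p + 1 ∧ α[(p : ℕ)]? = some k then (1 / 2 : ℂ) else 0

/-- Each row `p < |α|` has a single entry `1/2`, in the matrix of the `p`-th letter only; the last
row is zero. The weight `1/2` makes the row contraction strict. -/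
theorem sum_pathMatrix_mul (α : List (Fin d)) :
    ∑ k, pathMatrix α k * (pathMatrix α k).conjTranspose =
      Matrix.diagonal fun p : Fin (α.length + 1) => if (p : ℕ) < α.length then (1 / 4 : ℂ) else 0 := by
  ext p q
  rw [Matrix.sum_apply, Matrix.diagonal_apply]
  simp only [Matrix.mul_apply, Matrix.conjTranspose_apply, pathMatrix, Matrix.of_apply]
  by_cases hp : (p : ℕ) < α.length
  · rw [Finset.sum_eq_single (α[(p : ℕ)]), Finset.sum_eq_single ⟨p + 1, by omega⟩]
    · by_cases hpq : p = q
      · subst hpq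
        simp [hp]
        norm_num
      · have : (p : ℕ) ≠ q := fun h => hpq (Fin.ext h)
        simp [hpq, this]
    · intro r _ hr
      have : (r : ℕ) ≠ p + 1 := fun h => hr (Fin.ext h)
      simp [this]
    · simp
    · intro k _ hk
      refine Finset.sum_eq_zero fun r _ => ?_
      simp [hp, Ne.symm hk]
    · simp
  · simp [hp]

/-- A point of the ball at which the entry `(0, |α|)` separates the word `α`. -/
noncomputable def pathPoint (α : List (Fin d)) : NCBall d (α.length + 1) :=
  ⟨pathMatrix α, by
    have h : (1 - Matrix.diagonal fun p : Fin (α.length + 1) =>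
        if (p : ℕ) < α.length then (1 / 4 : ℂ) else 0) =
        Matrix.diagonal fun p : Fin (α.length + 1) => if (p : ℕ) < α.length then (3 / 4 : ℂ) else 1 := by
      rw [← Matrix.diagonal_one, Matrix.diagonal_sub]
      congr 1
      funext p
      split_ifs <;> norm_num
    rw [sum_pathMatrix_mul, h, Matrix.posDef_diagonal_iff]
    intro p
    split_ifs
    · simp
    · exact one_pos⟩

/-- Each letter moves one step along the superdiagonal at cost `1/2`, provided that it is the next
letter of `α`. -/
theorem pathPoint_word (α β : List (Fin d)) (p q : Fin (α.length + 1)) :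
    (pathPoint α).word β p q =
      if β <+: α.drop p ∧ (q : ℕ) = p + β.length then (1 / 2 : ℂ) ^ β.length else 0 := by
  induction β generalizing p with
  | nil =>
    simp [NCBall.word, Matrix.one_apply, Fin.ext_iff, eq_comm]
  | cons k β ih =>
    have h1 : (pathPoint α).word (k :: β) = pathMatrix α k * (pathPoint α).word β := by
      simp [NCBall.word, pathPoint]
    rw [h1, Matrix.mul_apply]
    simp only [ih]
    by_cases hp : (p : ℕ) < α.length
    · rw [Finset.sum_eq_single ⟨p + 1, by omega⟩]
      · have h2 : α.drop p = α[(p : ℕ)] :: α.drop (p + 1) := List.drop_eq_getElem_cons hp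
        simp only [h2, List.cons_prefix_cons]
        by_cases hk : α[(p : ℕ)] = k
        · simp [pathMatrix, hp, hk, pow_succ', add_assoc, add_comm 1]
        · simp [pathMatrix, hp, hk, Ne.symm hk]
      · intro r _ hr
        have : (r : ℕ) ≠ p + 1 := fun h => hr (Fin.ext h)
        simp [pathMatrix, this]
      · simp
    · have h2 : α[(p : ℕ)]? = none := by simpa using hp
      have h3 : α.drop p = [] := by simpa using hp
      simp [pathMatrix, h2, h3]

variable {V : Type*} [NormedAddCommGroup V] [InnerProductSpace ℂ V]

/-- Only the word `α` itself leads from position `0` to position `|α|`. -/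
theorem eval_pathPoint (f : Fock d V) (α : List (Fin d)) :
    eval f (pathPoint α) 0 (Fin.last _) = (1 / 2 : ℂ) ^ α.length • f α := by
  rw [eval, Matrix.of_apply, tsum_eq_single α]
  · rw [pathPoint_word, if_pos]
    simp
  · intro β hβ
    rw [pathPoint_word, if_neg, zero_smul]
    rintro ⟨h1, h2⟩
    simp only [Fin.val_zero, List.drop_zero, Fin.val_last, zero_add] at h1 h2
    exact hβ (h1.eq_of_length h2.symm)

theorem eval_ext {f g : Fock d V} (h : ∀ x : NCPoint d, eval f x.Z x.i x.j = eval g x.Z x.i x.j) :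
    f = g := by
  ext α
  have h1 := h ⟨_, pathPoint α, 0, Fin.last _⟩
  simp only [eval_pathPoint] at h1
  exact smul_right_injective V (pow_ne_zero _ (by norm_num)) h1

end Separation

/-! ### Creation operators and the vacuum -/

section Creation

open ContinuousLinearMap

variable {d : ℕ} {V : Type*} [NormedAddCommGroup V] [InnerProductSpace ℂ V]

/-- The embedding `h ↦ 1 ⊗ h` as a bounded operator. -/
noncomputable def vacL (d : ℕ) (V : Type*) [NormedAddCommGroup V] [InnerProductSpace ℂ V] :
    V →L[ℂ] Fock d V :=
  lp.singleContinuousLinearMap ℂ (fun _ => V) 2 []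

theorem vacL_apply (h : V) : vacL d V h = vac h := rfl

theorem vac_apply_nil (h : V) : (vac h : Fock d V) [] = h := lp.single_apply_self ..

theorem vac_apply_cons (h : V) (k : Fin d) (α : List (Fin d)) : (vac h : Fock d V) (k :: α) = 0 :=
  lp.single_apply_ne _ _ _ (by simp)

theorem adjoint_vacL_apply [CompleteSpace V] (f : Fock d V) : adjoint (vacL d V) f = f [] := by
  refine ext_inner_left ℂ fun v => ?_
  rw [adjoint_inner_right, vacL_apply, vac, lp.inner_single_left]

theorem creation_single (k : Fin d) (α : List (Fin d)) (v : V) :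
    creation k (lp.single 2 α v : Fock d V) = lp.single 2 (k :: α) v := by
  ext β
  by_cases h : ∃ γ, k :: γ = β
  · obtain ⟨γ, rfl⟩ := h
    rw [creation_apply_cons, lp.single_apply, lp.single_apply]
    by_cases hγ : γ = α
    · subst hγ
      simp
    · rw [Pi.single_eq_of_ne hγ, Pi.single_eq_of_ne (by simpa using hγ)]
  · rw [creation_apply_of_ne k _ β h, lp.single_apply_ne]
    rintro rfl
    exact h ⟨α, rfl⟩

theorem backShift_apply [CompleteSpace V] (k : Fin d) (f : Fock d V) (α : List (Fin d)) :
    backShift k f α = f (k :: α) := by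
  refine ext_inner_left ℂ fun v => ?_
  have h1 := lp.inner_single_left (𝕜 := ℂ) α v (backShift k f)
  have h2 := lp.inner_single_left (𝕜 := ℂ) (k :: α) v f
  rw [backShift, adjoint_inner_right] at h1
  rw [← creation_single] at h2
  exact h1.symm.trans h2

theorem backShift_creation [CompleteSpace V] (j k : Fin d) (f : Fock d V) :
    backShift j (creation k f) = if j = k then f else 0 := by
  ext α
  rw [backShift_apply]
  split_ifs with h
  · subst h
    rw [creation_apply_cons]
  · rw [creation_apply_of_ne k f _ (by rintro ⟨β, hβ⟩; simp_all)]
    simp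

theorem backShift_vac [CompleteSpace V] (k : Fin d) (h : V) :
    backShift k (vac h : Fock d V) = 0 := by
  ext α
  rw [backShift_apply, vac_apply_cons]
  simp

theorem creation_apply_nil (k : Fin d) (f : Fock d V) : creation k f [] = 0 :=
  creation_apply_of_ne k f [] (by simp)

/-- A word is either empty or begins with exactly one letter. -/
theorem vac_add_sum_creation_backShift [CompleteSpace V] (f : Fock d V) :
    vac (f []) + ∑ k, creation k (backShift k f) = f := by
  ext α
  rw [lp.coeFn_add, lp.coeFn_sum, Pi.add_apply, Finset.sum_apply]
  cases α with
  | nil => simp [vac_apply_nil, creation_apply_nil]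
  | cons j α =>
    rw [vac_apply_cons, zero_add, Finset.sum_eq_single j]
    · rw [creation_apply_cons, backShift_apply]
    · intro k _ hk
      exact creation_apply_of_ne k _ _ (by rintro ⟨β, hβ⟩; simp_all)
    · simp

theorem fock_ext_backShift [CompleteSpace V] {f g : Fock d V} (h0 : f [] = g [])
    (h : ∀ k, backShift k f = backShift k g) : f = g := by
  rw [← vac_add_sum_creation_backShift f, ← vac_add_sum_creation_backShift g, h0]
  simp only [h]

theorem eval_creation [CompleteSpace V] (k : Fin d) (f : Fock d V) {n : ℕ} (Z : NCBall d n)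
    (i j : Fin n) :
    eval (creation k f) Z i j = ∑ p, Z.1 k i p • eval f Z p j := by
  have hinj : Function.Injective (List.cons k) := List.cons_injective
  rw [eval, Matrix.of_apply, ← hinj.tsum_eq]
  · simp only [creation_apply_cons]
    have h1 : ∀ α, Z.word (k :: α) i j • f α = ∑ p, Z.1 k i p • (Z.word α p j • f α) := by
      intro α
      simp [NCBall.word, Matrix.mul_apply, Finset.sum_smul, mul_smul]
    simp only [h1]
    rw [Summable.tsum_finsetSum fun p _ => (summable_eval f Z p j).const_smul _]
    refine Finset.sum_congr rfl fun p _ => ?_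
    rw [tsum_const_smul'' , eval, Matrix.of_apply]
  · intro α hα
    by_contra h
    refine hα ?_
    simp only [creation_apply_of_ne k f α (by simpa using h), smul_zero]

theorem eval_vac (h : V) {n : ℕ} (Z : NCBall d n) (i j : Fin n) :
    eval (vac h) Z i j = (1 : Matrix (Fin n) (Fin n) ℂ) i j • h := by
  rw [eval, Matrix.of_apply, tsum_eq_single []]
  · rw [vac_apply_nil]
    simp [NCBall.word]
  · intro α hα
    rw [vac, lp.single_apply_ne _ _ _ hα, smul_zero]

theorem eval_zero_point (f : Fock d V) :
    eval f (NCPoint.zero d).Z (NCPoint.zero d).i (NCPoint.zero d).j = f [] := by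
  rw [eval, Matrix.of_apply, tsum_eq_single []]
  · change (1 : Matrix (Fin 1) (Fin 1) ℂ) 0 0 • f [] = f []
    simp
  · intro α hα
    cases α with
    | nil => exact absurd rfl hα
    | cons k α =>
      change ((0 : Matrix (Fin 1) (Fin 1) ℂ) * (NCBall.zero d 1).word α) 0 0 • f (k :: α) = 0
      simp

/-- A vector orthogonal to all of them has all its values zero, so `eval_ext` applies. -/
theorem span_entryAdj_dense [CompleteSpace V] :
    (Submodule.span ℂ (Set.range fun p : NCPoint d × V =>
      entryAdj p.1.Z p.1.i p.1.j p.2)).topologicalClosure = ⊤ := by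
  rw [Submodule.topologicalClosure_eq_top_iff, Submodule.eq_bot_iff]
  intro f hf
  refine eval_ext fun x => ext_inner_left ℂ fun v => ?_
  rw [← entryAdj_inner, ← entryAdj_inner, inner_zero_right]
  exact hf _ (Submodule.subset_span ⟨(x, v), rfl⟩)

end Creation

/-! ### Column operators into a finite Hilbert direct sum -/

section Columns

open ContinuousLinearMap

variable {d : ℕ} {E F : Type*} [NormedAddCommGroup E] [InnerProductSpace ℂ E] [CompleteSpace E]
  [NormedAddCommGroup F] [InnerProductSpace ℂ F] [CompleteSpace F]

/-- The column operator with entries `S k`. -/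
noncomputable def column (S : Fin d → E →L[ℂ] F) : E →L[ℂ] PiLp 2 fun _ : Fin d => F :=
  (PiLp.continuousLinearEquiv 2 ℂ fun _ : Fin d => F).symm.toContinuousLinearMap ∘L
    ContinuousLinearMap.pi S

theorem column_apply (S : Fin d → E →L[ℂ] F) (x : E) (k : Fin d) : column S x k = S k x := rfl

theorem adjoint_column_apply (S : Fin d → E →L[ℂ] F) (y : PiLp 2 fun _ : Fin d => F) :
    adjoint (column S) y = ∑ k, adjoint (S k) (y k) := by
  refine ext_inner_right ℂ fun x => ?_
  rw [adjoint_inner_left, PiLp.inner_apply, sum_inner]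
  simp only [column_apply, adjoint_inner_left]

end Columns

open ContinuousLinearMap

variable {d : ℕ} {H J : Type*} [NormedAddCommGroup H] [InnerProductSpace ℂ H] [CompleteSpace H]
  [NormedAddCommGroup J] [InnerProductSpace ℂ J] [CompleteSpace J]

/-! ### Right multipliers and creation operators -/

section Multiplier

variable (A : RightSchur d H J)

/-- On values, `L_k` multiplies by `Z_k` from the left and `A` by `A^†(Z)` from the right, so the
two commute. -/
theorem RightSchur.op_creation (k : Fin d) (f : Fock d H) :
    A.op (creation k f) = creation k (A.op f) := by
  refine eval_ext fun x => ?_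
  rw [A.eval_op, eval_creation]
  simp only [A.eval_op, rightProd, Matrix.of_apply, eval_creation, map_sum, map_smul,
    Finset.smul_sum]
  exact Finset.sum_comm

theorem RightSchur.backShift_adjoint_op (k : Fin d) (f : Fock d J) :
    backShift k (adjoint A.op f) = adjoint A.op (backShift k f) := by
  refine ext_inner_right ℂ fun g => ?_
  rw [backShift, backShift, adjoint_inner_left, adjoint_inner_left, adjoint_inner_left,
    adjoint_inner_left]
  change ⟪f, A.op (creation k g)⟫_ℂ = ⟪f, creation k (A.op g)⟫_ℂ
  rw [A.op_creation]

theorem RightSchur.eval_op_vac (h : H) (x : NCPoint d) :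
    eval (A.op (vac h)) x.Z x.i x.j = A.symbol x.n x.Z x.i x.j h := by
  rw [A.eval_op, rightProd, Matrix.of_apply, Finset.sum_eq_single x.i]
  · rw [eval_vac]
    simp
  · intro p _ hp
    rw [eval_vac, Matrix.one_apply_ne hp.symm]
    simp
  · simp

theorem RightSchur.op_vac_nil (h : H) : A.op (vac h) [] = A.atZero h := by
  rw [← eval_zero_point, A.eval_op_vac]
  rfl

theorem RightSchur.norm_adjoint_op_le (f : Fock d J) : ‖adjoint A.op f‖ ≤ ‖f‖ := by
  have h1 : ‖adjoint A.op‖ ≤ 1 := by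
    rw [LinearIsometryEquiv.norm_map]
    exact A.norm_op_le
  simpa using (adjoint A.op).le_of_opNorm_le h1 f

end Multiplier

/-! ### The contractive inclusion of `𝓗^R(A)` in the Fock space -/

section Inclusion

variable (A : RightSchur d H J)

/-- The Gram matrix of the kernel functions is that of the Fock evaluation vectors minus that of
their images under `A^*`, so the correspondence is contractive. -/
theorem RightSchur.exists_coinclusion : ∃ W : Fock d J →L[ℂ] A.HR,
    ∀ (x : NCPoint d) (b : J), W (entryAdj x.Z x.i x.j b) = RKHS.kerFun A.HR x b := by
  -- Formal combinations bypass the question whether the map is well defined on the span; the norm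
  -- bound settles it.
  set e : (NCPoint d × J →₀ ℂ) →ₗ[ℂ] Fock d J := Finsupp.linearCombination ℂ
    fun p : NCPoint d × J => entryAdj p.1.Z p.1.i p.1.j p.2 with he
  set f : (NCPoint d × J →₀ ℂ) →ₗ[ℂ] A.HR := Finsupp.linearCombination ℂ
    fun p : NCPoint d × J => RKHS.kerFun A.HR p.1 p.2 with hf
  have hker : ∀ (p q : NCPoint d × J), ⟪RKHS.kerFun A.HR p.1 p.2, RKHS.kerFun A.HR q.1 q.2⟫_ℂ =
      ⟪entryAdj p.1.Z p.1.i p.1.j p.2, entryAdj q.1.Z q.1.i q.1.j q.2⟫_ℂ -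
      ⟪adjoint A.op (entryAdj p.1.Z p.1.i p.1.j p.2),
        adjoint A.op (entryAdj q.1.Z q.1.i q.1.j q.2)⟫_ℂ := by
    intro p q
    rw [← kernelMatrix_inner, ← A.kernel_HR, RKHS.kernel_inner]
  have hinner : ∀ c c', ⟪f c, f c'⟫_ℂ = ⟪e c, e c'⟫_ℂ -
      ⟪adjoint A.op (e c), adjoint A.op (e c')⟫_ℂ := by
    intro c c'
    induction c using Finsupp.induction_linear with
    | zero => simp
    | add a b ha hb =>
      simp only [map_add, inner_add_left, ha, hb]
      ring
    | single p z =>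
      induction c' using Finsupp.induction_linear with
      | zero => simp
      | add a b ha hb =>
        simp only [map_add, inner_add_right, ha, hb]
        ring
      | single q w =>
        simp only [he, hf, Finsupp.linearCombination_single, map_smul, inner_smul_left,
          inner_smul_right, hker]
        ring
  have hn : ∀ c, ‖f c‖ ≤ ‖e c‖ := by
    intro c
    have h1 := hinner c c
    rw [inner_self_eq_norm_sq_to_K, inner_self_eq_norm_sq_to_K, inner_self_eq_norm_sq_to_K] at h1
    have h2 : ‖f c‖ ^ 2 = ‖e c‖ ^ 2 - ‖adjoint A.op (e c)‖ ^ 2 := by exact_mod_cast h1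
    exact (sq_le_sq₀ (norm_nonneg _) (norm_nonneg _)).1
      (by nlinarith [sq_nonneg ‖adjoint A.op (e c)‖])
  obtain ⟨W, hW, -⟩ := exists_clm_comp_eq e f hn
  refine ⟨W, fun x b => ?_⟩
  simpa [he, hf] using hW (Finsupp.single (x, b) 1)

/-- The inclusion of `𝓗^R(A)` in `F²_d ⊗ J`: a function is mapped to its Fock coefficients. -/
noncomputable def RightSchur.incl : A.HR →L[ℂ] Fock d J := adjoint A.exists_coinclusion.choose

theorem RightSchur.eval_incl (F : A.HR) (x : NCPoint d) : eval (A.incl F) x.Z x.i x.j = F x := by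
  refine ext_inner_left ℂ fun v => ?_
  rw [← entryAdj_inner, RightSchur.incl, adjoint_inner_right, A.exists_coinclusion.choose_spec,
    RKHS.kerFun_inner]

theorem RightSchur.incl_injective : Function.Injective A.incl := fun F G h =>
  RKHS.ext fun x => by rw [← A.eval_incl, ← A.eval_incl, h]

theorem RightSchur.adjoint_incl_entryAdj (x : NCPoint d) (b : J) :
    adjoint A.incl (entryAdj x.Z x.i x.j b) = RKHS.kerFun A.HR x b := by
  rw [RightSchur.incl, adjoint_adjoint, A.exists_coinclusion.choose_spec]

/-- On evaluation vectors this is the formula for the kernel; density gives the rest. -/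
theorem RightSchur.incl_adjoint_incl (u : Fock d J) :
    A.incl (adjoint A.incl u) = u - A.op (adjoint A.op u) := by
  have h : A.incl ∘L adjoint A.incl = ContinuousLinearMap.id ℂ _ - A.op ∘L adjoint A.op := by
    refine ContinuousLinearMap.ext_on (Submodule.dense_iff_topologicalClosure_eq_top.2
      span_entryAdj_dense) ?_
    rintro _ ⟨⟨y, b⟩, rfl⟩
    refine eval_ext fun x => ext_inner_left ℂ fun v => ?_
    simp only [comp_apply, sub_apply, id_apply]
    rw [← entryAdj_inner, ← entryAdj_inner, inner_sub_right, ← adjoint_inner_left,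
      ← adjoint_inner_left A.op, A.adjoint_incl_entryAdj, A.adjoint_incl_entryAdj,
      ← RKHS.kernel_inner, A.kernel_HR, kernelMatrix_inner]
  exact DFunLike.congr_fun h u

theorem RightSchur.norm_adjoint_incl_sq (u : Fock d J) :
    ‖adjoint A.incl u‖ ^ 2 = ‖u‖ ^ 2 - ‖adjoint A.op u‖ ^ 2 := by
  have h : ⟪adjoint A.incl u, adjoint A.incl u⟫_ℂ = ⟪u, u⟫_ℂ -
      ⟪adjoint A.op u, adjoint A.op u⟫_ℂ := by
    rw [adjoint_inner_left, A.incl_adjoint_incl, inner_sub_right, adjoint_inner_left]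
  rw [inner_self_eq_norm_sq_to_K, inner_self_eq_norm_sq_to_K, inner_self_eq_norm_sq_to_K] at h
  exact_mod_cast h

/-- By `norm_adjoint_incl_sq` the hypothesis reads `‖Y^* u‖ ≤ ‖ι^* u‖`, so `Y^*` factors through
`ι^*`; take adjoints. -/
theorem RightSchur.exists_lift {E : Type*} [NormedAddCommGroup E] [InnerProductSpace ℂ E]
    [CompleteSpace E] (Y : E →L[ℂ] Fock d J)
    (h : ∀ u, ‖adjoint Y u‖ ^ 2 ≤ ‖u‖ ^ 2 - ‖adjoint A.op u‖ ^ 2) :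
    ∃ Z : E →L[ℂ] A.HR, ∀ x, A.incl (Z x) = Y x := by
  obtain ⟨B, hB, -⟩ := exists_clm_comp_eq (adjoint A.incl : Fock d J →ₗ[ℂ] A.HR)
    (adjoint Y : Fock d J →ₗ[ℂ] E) fun u => by
      refine (sq_le_sq₀ (norm_nonneg _) (norm_nonneg _)).1 ?_
      exact (h u).trans_eq (A.norm_adjoint_incl_sq u).symm
  refine ⟨adjoint B, fun x => ext_inner_left ℂ fun u => ?_⟩
  rw [← adjoint_inner_left, adjoint_inner_right, ← adjoint_inner_left Y]
  exact congrArg (⟪·, x⟫_ℂ) (hB u)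

end Inclusion

/-! ### The canonical colligation -/

section Canonical

variable (A : RightSchur d H J)

theorem adjoint_backShift (k : Fin d) (u : Fock d J) :
    adjoint (backShift k) u = creation k u := by
  rw [backShift, adjoint_adjoint]
  rfl

theorem RightSchur.backShift_adjoint_op_creation (j k : Fin d) (u : Fock d J) :
    backShift j (adjoint A.op (creation k u)) = if j = k then adjoint A.op u else 0 := by
  rw [A.backShift_adjoint_op, backShift_creation]
  split_ifs <;> simp

/-- `A^*` commutes with backward shifts, so `L_j^* A^* L_k u = δ_{jk} A^* u`, leaving only the
vacuum coefficient free. -/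
theorem RightSchur.adjoint_op_creation (k : Fin d) (u : Fock d J) :
    adjoint A.op (creation k u) =
      vac (adjoint A.op (creation k u) []) + creation k (adjoint A.op u) := by
  conv_lhs => rw [← vac_add_sum_creation_backShift (adjoint A.op (creation k u))]
  congr 1
  rw [Finset.sum_eq_single k]
  · rw [A.backShift_adjoint_op_creation, if_pos rfl]
  · intro j _ hj
    rw [A.backShift_adjoint_op_creation, if_neg hj, map_zero]
  · simp

theorem RightSchur.norm_adjoint_op_creation_sq (k : Fin d) (u : Fock d J) :
    ‖adjoint A.op (creation k u)‖ ^ 2 =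
      ‖adjoint A.op (creation k u) []‖ ^ 2 + ‖adjoint A.op u‖ ^ 2 := by
  have h0 : ⟪(vac (adjoint A.op (creation k u) []) : Fock d H),
      creation k (adjoint A.op u)⟫_ℂ = 0 := by
    rw [vac, lp.inner_single_left, creation_apply_nil, inner_zero_right]
  conv_lhs => rw [A.adjoint_op_creation]
  rw [sq, norm_add_sq_eq_norm_sq_add_norm_sq_of_inner_eq_zero _ _ h0, LinearIsometry.norm_map, vac,
    lp.norm_single (by norm_num), sq, sq]

theorem RightSchur.exists_shift_entry (k : Fin d) :
    ∃ Z : A.HR →L[ℂ] A.HR, ∀ F, A.incl (Z F) = backShift k (A.incl F) := by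
  refine A.exists_lift (backShift k ∘L A.incl) fun u => ?_
  rw [adjoint_comp, comp_apply, adjoint_backShift, A.norm_adjoint_incl_sq,
    LinearIsometry.norm_map, A.norm_adjoint_op_creation_sq]
  nlinarith [sq_nonneg ‖adjoint A.op (creation k u) []‖]

theorem RightSchur.exists_gleason_entry (k : Fin d) :
    ∃ Z : H →L[ℂ] A.HR, ∀ h, A.incl (Z h) = backShift k (A.op (vac h)) := by
  refine A.exists_lift (backShift k ∘L A.op ∘L vacL d H) fun u => ?_
  rw [adjoint_comp, adjoint_comp, comp_apply, comp_apply, adjoint_backShift, adjoint_vacL_apply]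
  have h1 := A.norm_adjoint_op_creation_sq k u
  have h2 := A.norm_adjoint_op_le (creation k u)
  rw [LinearIsometry.norm_map] at h2
  have h3 := pow_le_pow_left₀ (norm_nonneg _) h2 2
  linarith

/-- The backward shift `X = (L^* ⊗ I_J)|_{𝓗^R(A)}`. -/
noncomputable def RightSchur.shift : A.HR →L[ℂ] A.HRd :=
  column fun k => (A.exists_shift_entry k).choose

/-- The operator `𝐀 = (L^* ⊗ I_J) A`. -/
noncomputable def RightSchur.gleason : H →L[ℂ] A.HRd :=
  column fun k => (A.exists_gleason_entry k).choose

theorem RightSchur.incl_shift (F : A.HR) (k : Fin d) :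
    A.incl (A.shift F k) = backShift k (A.incl F) :=
  (A.exists_shift_entry k).choose_spec F

theorem RightSchur.incl_gleason (h : H) (k : Fin d) :
    A.incl (A.gleason h k) = backShift k (A.op (vac h)) :=
  (A.exists_gleason_entry k).choose_spec h

theorem RightSchur.isRestrictedBackShift_shift : A.IsRestrictedBackShift A.shift := fun F =>
  ⟨A.incl F, fun x => (A.eval_incl F x).symm, fun k x => by rw [← A.eval_incl, A.incl_shift]⟩

theorem RightSchur.isGleason_gleason : A.IsGleason A.gleason := fun h k x => by
  rw [← A.eval_incl, A.incl_gleason]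

theorem RightSchur.incl_apply_nil (F : A.HR) : A.incl F [] = adjoint A.K0 F := by
  rw [← eval_zero_point, A.eval_incl, RightSchur.K0, RKHS.adjoint_kerFun]

theorem RightSchur.adjoint_incl_vac (b : J) : adjoint A.incl (vac b) = A.K0 b := by
  refine ext_inner_right ℂ fun F => ?_
  rw [adjoint_inner_left, vac, lp.inner_single_left, A.incl_apply_nil, adjoint_inner_right]

theorem RightSchur.adjoint_atZero_apply (b : J) :
    adjoint A.atZero b = adjoint A.op (vac b) [] := by
  refine ext_inner_right ℂ fun h => ?_
  rw [adjoint_inner_left, ← A.op_vac_nil, ← adjoint_vacL_apply, adjoint_inner_right, vacL_apply,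
    ← adjoint_vacL_apply, adjoint_inner_left, vacL_apply, adjoint_inner_left]

theorem RightSchur.adjoint_incl_dense :
    Dense (LinearMap.range (adjoint A.incl : Fock d J →ₗ[ℂ] A.HR) : Set A.HR) := by
  rw [Submodule.dense_iff_topologicalClosure_eq_top, Submodule.topologicalClosure_eq_top_iff,
    orthogonal_range, adjoint_adjoint]
  exact LinearMap.ker_eq_bot.2 A.incl_injective

theorem RightSchur.adjoint_shift_incl (k : Fin d) (u : Fock d J) :
    adjoint (A.exists_shift_entry k).choose (adjoint A.incl u) =
      adjoint A.incl (creation k u) := by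
  refine ext_inner_right ℂ fun F => ?_
  rw [adjoint_inner_left, adjoint_inner_left, adjoint_inner_left,
    (A.exists_shift_entry k).choose_spec, ← adjoint_inner_left, adjoint_backShift]

theorem RightSchur.adjoint_gleason_incl (k : Fin d) (u : Fock d J) :
    adjoint (A.exists_gleason_entry k).choose (adjoint A.incl u) =
      adjoint A.op (creation k u) [] := by
  refine ext_inner_right ℂ fun h => ?_
  rw [adjoint_inner_left, adjoint_inner_left, (A.exists_gleason_entry k).choose_spec,
    ← adjoint_inner_left, adjoint_backShift, ← adjoint_vacL_apply, adjoint_inner_left,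
    vacL_apply, adjoint_inner_left]

/-- On `F = ι^* u`, after applying `ι`, the sum is `L_j^* (I - AA^*) L_k u + L_j^* A (A^* L_k u -
L_k A^* u)`; the terms with `A A^* L_k u` cancel. -/
theorem RightSchur.state_entry (j k : Fin d) (F : A.HR) :
    (A.exists_shift_entry j).choose (adjoint (A.exists_shift_entry k).choose F) +
      (A.exists_gleason_entry j).choose (adjoint (A.exists_gleason_entry k).choose F) =
      if j = k then F else 0 := by
  refine A.adjoint_incl_dense.induction (P := fun F =>
    (A.exists_shift_entry j).choose (adjoint (A.exists_shift_entry k).choose F) +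
      (A.exists_gleason_entry j).choose (adjoint (A.exists_gleason_entry k).choose F) =
      if j = k then F else 0) ?_
    (isClosed_eq (by fun_prop) (by split_ifs <;> fun_prop)) F
  rintro _ ⟨u, rfl⟩
  refine A.incl_injective ?_
  have h1 : A.op (vac (adjoint A.op (creation k u) [])) = A.op (adjoint A.op (creation k u)) -
      creation k (A.op (adjoint A.op u)) := by
    rw [← A.op_creation, ← map_sub]
    congr 1
    conv_rhs => rw [A.adjoint_op_creation]
    abel
  simp only [coe_coe]
  rw [map_add, (A.exists_shift_entry j).choose_spec, (A.exists_gleason_entry j).choose_spec,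
    A.adjoint_shift_incl, A.adjoint_gleason_incl, A.incl_adjoint_incl, h1, map_sub, map_sub,
    backShift_creation, backShift_creation]
  split_ifs
  · rw [A.incl_adjoint_incl]
    abel
  · rw [map_zero]
    abel

theorem RightSchur.isCoisometricColligation :
    IsCoisometricColligation A.shift A.gleason A.K0 A.atZero where
  state g := by
    ext j
    rw [PiLp.add_apply, RightSchur.shift, RightSchur.gleason, adjoint_column_apply,
      adjoint_column_apply, column_apply, column_apply, map_sum, map_sum,
      ← Finset.sum_add_distrib]
    simp only [A.state_entry]
    simp
  mixed b := by
    refine PiLp.ext fun j => A.incl_injective ?_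
    rw [PiLp.add_apply, map_add, A.incl_shift, A.incl_gleason, ← A.adjoint_incl_vac,
      A.incl_adjoint_incl, A.adjoint_atZero_apply, ← map_add]
    -- `A^*` sends vacuum vectors to vacuum vectors, because it commutes with the backward shifts,
    -- which annihilate them.
    have h : adjoint A.op (vac b) = vac (adjoint A.op (vac b) []) := by
      conv_lhs => rw [← vac_add_sum_creation_backShift (adjoint A.op (vac b))]
      simp [A.backShift_adjoint_op, backShift_vac]
    rw [← h, sub_add_cancel, backShift_vac]
    simp
  output b := by
    have h : adjoint A.op (vac b) = vac (adjoint A.op (vac b) []) := by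
      conv_lhs => rw [← vac_add_sum_creation_backShift (adjoint A.op (vac b))]
      simp [A.backShift_adjoint_op, backShift_vac]
    rw [← A.incl_apply_nil, ← A.adjoint_incl_vac, A.incl_adjoint_incl, A.adjoint_atZero_apply,
      ← A.op_vac_nil, ← h, lp.coeFn_sub, Pi.sub_apply, vac_apply_nil, sub_add_cancel]

end Canonical

/-! ### The graph of `Â` -/

section Graph

variable (A : RightSchur d H J)

theorem RightSchur.eq_of_shift_eq {F G : A.HR} (hX : A.shift F = A.shift G)
    (hK : adjoint A.K0 F = adjoint A.K0 G) : F = G := by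
  refine A.incl_injective (fock_ext_backShift ?_ fun k => ?_)
  · rw [A.incl_apply_nil, A.incl_apply_nil, hK]
  · rw [← A.incl_shift, ← A.incl_shift, hX]

/-- The two equations match the backward shifts and vacuum coefficients of `ι F` and `A(1 ⊗ h)`, so
these vectors coincide. -/
theorem RightSchur.mem_hat_graph_iff (h : H) (F : A.HR) : (h, F) ∈ A.hat.graph ↔
    A.shift F = A.gleason h ∧ adjoint A.K0 F = A.atZero h := by
  have h1 : (A.shift F = A.gleason h ∧ adjoint A.K0 F = A.atZero h) ↔
      A.incl F = A.op (vac h) := by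
    constructor
    · rintro ⟨hX, hK⟩
      refine fock_ext_backShift ?_ fun k => ?_
      · rw [A.incl_apply_nil, hK, A.op_vac_nil]
      · rw [← A.incl_shift, hX, A.incl_gleason]
    · intro hF
      constructor
      · refine PiLp.ext fun k => A.incl_injective ?_
        rw [A.incl_shift, hF, A.incl_gleason]
      · rw [← A.incl_apply_nil, hF, A.op_vac_nil]
  rw [h1, LinearPMap.mem_graph_iff]
  constructor
  · rintro ⟨y, rfl, rfl⟩
    refine eval_ext fun x => ?_
    rw [A.eval_incl, A.eval_op_vac]
    exact A.hat_apply y x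
  · intro hF
    have hF' : ∀ x : NCPoint d, F x = A.symbol x.n x.Z x.i x.j h := fun x => by
      rw [← A.eval_incl, hF, A.eval_op_vac]
    refine ⟨⟨h, F, hF'⟩, rfl, RKHS.ext fun x => ?_⟩
    exact (A.hat_apply ⟨h, F, hF'⟩ x).trans (hF' x).symm

theorem RightSchur.isClosed_hat : A.hat.IsClosed := by
  have h : (A.hat.graph : Set (H × A.HR)) =
      {p | A.shift p.2 = A.gleason p.1} ∩ {p | adjoint A.K0 p.2 = A.atZero p.1} := by
    ext ⟨h, F⟩
    exact A.mem_hat_graph_iff h F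
  rw [LinearPMap.IsClosed, h]
  exact (isClosed_eq (by fun_prop) (by fun_prop)).inter (isClosed_eq (by fun_prop) (by fun_prop))

theorem RightSchur.mem_hatCl_graph_iff (h : A.dom.topologicalClosure) (F : A.HR) :
    (h, F) ∈ A.hatCl.graph ↔ ((h : H), F) ∈ A.hat.graph := by
  rw [LinearPMap.mem_graph_iff, LinearPMap.mem_graph_iff]
  constructor
  · rintro ⟨y, rfl, rfl⟩
    exact ⟨⟨_, y.2⟩, rfl, rfl⟩
  · rintro ⟨y, hy, rfl⟩
    simp only at hy
    refine ⟨⟨h, ?_⟩, rfl, ?_⟩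
    · change (h : H) ∈ A.dom
      rw [← hy]
      exact y.2
    · change A.hat ⟨(h : H), _⟩ = A.hat y
      congr 1
      exact Subtype.ext hy.symm

theorem RightSchur.isClosed_hatCl : A.hatCl.IsClosed := by
  have h : (A.hatCl.graph : Set (A.dom.topologicalClosure × A.HR)) =
      (fun p : A.dom.topologicalClosure × A.HR => ((p.1 : H), p.2)) ⁻¹' A.hat.graph := by
    ext ⟨h, F⟩
    exact A.mem_hatCl_graph_iff h F
  rw [LinearPMap.IsClosed, h]
  exact A.isClosed_hat.preimage (by fun_prop)

theorem RightSchur.dense_hatCl_domain :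
    Dense (A.hatCl.domain : Set A.dom.topologicalClosure) := by
  intro y
  rw [closure_subtype]
  have h : (Subtype.val '' (A.hatCl.domain : Set A.dom.topologicalClosure) : Set H) = A.dom := by
    ext h
    constructor
    · rintro ⟨y, hy, rfl⟩
      exact hy
    · intro hh
      exact ⟨⟨h, A.dom.le_topologicalClosure hh⟩, hh, rfl⟩
  rw [h]
  exact y.2

end Graph

end FreeDBR

/-! ### The main theorem -/

open FreeDBR FreeDBR.IsCoisometricColligation in
theorem proposition5p8 {d : ℕ} {H J : Type*}
    [NormedAddCommGroup H] [InnerProductSpace ℂ H] [CompleteSpace H]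
    [NormedAddCommGroup J] [InnerProductSpace ℂ J] [CompleteSpace J]
    (A : FreeDBR.RightSchur d H J) :
    -- the backward shifts `X = L^*|` and `𝐀 = L^* A` are well-defined bounded operators
    -- into `𝓗^R(A) ⊗ ℂ^d`
    ∃ (X : A.HR →L[ℂ] A.HRd) (bA : H →L[ℂ] A.HRd),
      A.IsRestrictedBackShift X ∧ A.IsGleason bA ∧
      -- the positive operator `a_∅` with `a_∅² = I - A(0)^* A(0) - 𝐀^* 𝐀`
      ∃ a : H →L[ℂ] H, a.IsPositive ∧
        a ∘L a = ContinuousLinearMap.id ℂ H -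
          ContinuousLinearMap.adjoint A.atZero ∘L A.atZero -
          ContinuousLinearMap.adjoint bA ∘L bA ∧
        -- `Â` is closed, both in `H` and in the closure of `𝓓_A`
        A.hat.IsClosed ∧ A.hatCl.IsClosed ∧
        -- `Dom Â = 𝓓_A = ran a_∅`
        A.hat.domain = A.dom ∧ A.dom = LinearMap.range (a : H →ₗ[ℂ] H) ∧
        -- `a_∅² (I + Â^* Â) h = h` for all `h ∈ Dom (Â^* Â)`
        (∀ h : (FreeDBR.adjMulSelf A.hatCl).domain,
          a (a ((h : A.dom.topologicalClosure) + FreeDBR.adjMulSelf A.hatCl h :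
            A.dom.topologicalClosure)) = ((h : A.dom.topologicalClosure) : H)) ∧
        -- `a_∅²` restricts to a bounded operator `S` of the closure of `𝓓_A`, and
        -- `S = (I + Â^* Â)⁻¹`
        (∃ S : A.dom.topologicalClosure →L[ℂ] A.dom.topologicalClosure,
          (∀ g, (S g : H) = a (a g)) ∧
          LinearMap.ker ((LinearMap.id : A.dom.topologicalClosure →ₗ[ℂ] A.dom.topologicalClosure)
            +ᵥ FreeDBR.adjMulSelf A.hatCl).toFun = ⊥ ∧
          ((LinearMap.id : A.dom.topologicalClosure →ₗ[ℂ] A.dom.topologicalClosure)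
            +ᵥ FreeDBR.adjMulSelf A.hatCl).inverse =
            (S : A.dom.topologicalClosure →ₗ[ℂ] A.dom.topologicalClosure).toPMap ⊤) ∧
        -- `Â a_∅` is a bounded operator `B` and `I - X^* X = K_0^A (K_0^A)^* + B B^*`
        ∃ B : H →L[ℂ] A.HR,
          (∀ h, ∃ hm : a h ∈ A.hat.domain, B h = A.hat ⟨a h, hm⟩) ∧
          ContinuousLinearMap.id ℂ A.HR - ContinuousLinearMap.adjoint X ∘L X =
            A.K0 ∘L ContinuousLinearMap.adjoint A.K0 + B ∘L ContinuousLinearMap.adjoint B := by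
  have hU := A.isCoisometricColligation
  obtain ⟨a, ha, haa⟩ := exists_isPositive_sqrt hU.isPositive_defect
  obtain ⟨B, hBa, hBX, hBK⟩ := hU.exists_factor ha haa
  have haa' : ∀ h, a (a h) = defect A.gleason A.atZero h := fun h => by rw [← haa]; rfl
  have hBg : ∀ h, (a h, B h) ∈ A.hat.graph := fun h =>
    (A.mem_hat_graph_iff _ _).2 ⟨hBX h, hBK h⟩
  have hadj : ∀ F, ContinuousLinearMap.adjoint (cross A.shift A.gleason A.K0 A.atZero) F =
      a (ContinuousLinearMap.adjoint B F) := fun F => by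
    rw [← hBa, ContinuousLinearMap.adjoint_comp, ContinuousLinearMap.comp_apply,
      ha.isSelfAdjoint.adjoint_eq]
  have hran : ∀ h, a h ∈ A.dom := fun h => LinearPMap.mem_domain_of_mem_graph (hBg h)
  set S : A.dom.topologicalClosure →L[ℂ] A.dom.topologicalClosure :=
    ((a ∘L a) ∘L A.dom.topologicalClosure.subtypeL).codRestrict A.dom.topologicalClosure
      (fun g => A.dom.le_topologicalClosure (hran _)) with hS
  have hSa : ∀ g, (S g : H) = a (a g) := fun g => rfl
  -- `B a = cross`, so `(S g, Q g)` is the projection of `(g, 0)` on the graph.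
  set Q : A.dom.topologicalClosure → A.HR := fun g => B (a g) with hQ
  have hmem : ∀ g, (S g, Q g) ∈ A.hatCl.graph := fun g =>
    (A.mem_hatCl_graph_iff _ _).2 (hBg (a g))
  have hinner : ∀ g v w, (v, w) ∈ A.hatCl.graph →
      inner ℂ (Q g) w = inner ℂ (g - S g) v := by
    intro g v w hvw
    obtain ⟨h1, h2⟩ := (A.mem_hat_graph_iff _ _).1 ((A.mem_hatCl_graph_iff _ _).1 hvw)
    have h3 := inner_cross (g : H) (v : H) w h1 h2
    rw [← haa', ← hBa] at h3
    exact h3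
  have hd := A.dense_hatCl_domain
  refine ⟨A.shift, A.gleason, A.isRestrictedBackShift_shift, A.isGleason_gleason, a, ha, haa,
    A.isClosed_hat, A.isClosed_hatCl, rfl, ?_, ?_, ⟨S, hSa, ker_id_vadd_adjMulSelf hd,
    inverse_id_vadd_adjMulSelf hd hmem hinner⟩, B, ?_, ?_⟩
  · refine le_antisymm (fun h hh => ?_) ?_
    · obtain ⟨F, hF⟩ := LinearPMap.mem_domain_iff.1 (show h ∈ A.hat.domain from hh)
      obtain ⟨h1, h2⟩ := (A.mem_hat_graph_iff _ _).1 hF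
      -- With `F = Â h`, `h - a² h = cross^* F = a B^* F`, so `h = a (B^* F + a h)`.
      refine ⟨ContinuousLinearMap.adjoint B F + a h, ?_⟩
      have h3 := adjoint_cross_apply (X := A.shift) (T := A.gleason) (K := A.K0)
        (C := A.atZero) F
      have h4 := sub_defect (T := A.gleason) (C := A.atZero) h
      rw [hadj, h1, h2, add_comm, ← h4, ← haa'] at h3
      change a (_ + _) = h
      rw [map_add, h3, sub_add_cancel]
    · rintro _ ⟨h, rfl⟩
      exact hran h
  · intro h
    rw [← hSa, apply_add_adjMulSelf hd hmem hinner h]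
  · intro h
    obtain ⟨y, hy, hy'⟩ := (LinearPMap.mem_graph_iff _).1 (hBg h)
    refine ⟨hran h, ?_⟩
    change A.hat y = B h at hy'
    rw [← hy']
    congr 1
    exact Subtype.ext hy
  · ext1 F
    -- Both sides have the same backward shifts and the same value at `0`, which determine an
    -- element of `𝓗^R(A)`.
    have h1 : F - ContinuousLinearMap.adjoint A.shift (A.shift F) -
        A.K0 (ContinuousLinearMap.adjoint A.K0 F) = B (ContinuousLinearMap.adjoint B F) := by
      refine A.eq_of_shift_eq ?_ ?_
      · rw [hU.apply_stateDefect, hBX, hadj]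
      · rw [hU.adjoint_apply_stateDefect, hBK, hadj]
    change F - ContinuousLinearMap.adjoint A.shift (A.shift F) =
      A.K0 (ContinuousLinearMap.adjoint A.K0 F) + B (ContinuousLinearMap.adjoint B F)
    rw [← h1]
    abel
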